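/- Let $n\ge 0$ and $q,p\in\mathbb C^\times$ with $q^2\neq -1$. Let $R=R_n(q,p)$ be the two-parameter Cremmer–Gervais $R$-matrix, with entries ($1\le i,j,k,l\le n$) $$pR_{ij}^{kl}=\begin{cases} q\,p^{2(l-i)} & i=k\ge j=l,\\ q^{-1}p^{2(l-i)} & i=k<j=l,\\ (q-q^{-1})p^{2(l-i)} & j\le k<i,\ i+j=k+l,\\ (q^{-1}-q)p^{2(l-i)} & i<k<j,\ i+j=k+l,\\ 0&\text{otherwise.}\end{cases}$$ Let $A(R)$ be the $\mathbb C$-bialgebra with generators $T_i^k$, relations $\sum_{u,v}R_{ji}^{uv}T_u^kT_v^l=\sum_{u,v}R_{vu}^{kl}T_i^uT_j^v$, coproduct $T_i^k\mapsto\sum_m T_i^m\otimes T_m^k$ and counit $T_i^k\mapsto\delta_{ik}$. A braiding on a bialgebra $A$ is a bilinear pairing $\langle\,|\,\rangle$, convolution invertible in $(A\otimes A)^*$, with $$\sum\langle a_{1}|b_{1}\rangle b_{2}a_{2}=\sum\langle a_{2}|b_{2}\rangle a_{1}b_{1},\quad \langle a|bc\rangle=\sum\langle a_{1}|b\rangle\langle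 a_{2}|c\rangle,\quad \langle ab|c\rangle=\sum\langle b|c_{1}\rangle\langle a|c_{2}\rangle .$$ Let $\Lambda(R)$ be the algebra generated by $x_1,\dots,x_n$ with relations $q^{-1}x_jx_i+\sum_{k,l}pR_{ij}^{kl}x_kx_l=0$ for all $i,j$, and let $\rho:\Lambda(R)\to A(R)\otimes\Lambda(R)$ be the algebra map with $\rho(x_i)=\sum_jT_i^j\otimes x_j$. There is exactly one braiding on $A(R)$ with $\langle T_i^k|T_j^l\rangle=R_{ji}^{lk}$, and there is exactly one element $\det_q\in A(R)$ with $\rho(x_1\cdots x_n)=\det_q\otimes x_1\cdots x_n$; it is group-like. Moreover: 1. For each $\sigma\in S_n$ there is a unique scalar $a_\sigma$ with $x_{\sigma(1)}\cdots x_{\sigma(n)}=a_\sigma x_1\cdots x_n$ in $\Lambda(R)$, and $\det_q=\sum_{\sigma\in S_n}a_\sigma T_1^{\sigma(1)}\cdots T_n^{\sigma(n)}$. 2. For all $i,k$: $\langle\det_q|T_i^k\rangle=(q^{-1}p^n)^{n-2i}\delta_{ik}$ and $\langle T_i^k|\det_q\rangle=(q^{-1}p^n)^{-(n-2i+2)}\delta_{ik}$.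 3. For all $i,k$: $T_i^k\det_q=(q^{-1}p^n)^{2(i-k)}\det_qT_i^k$. Hence $\det_q$ is normal in $A(R)$, i.e. $\det_q A(R)=A(R)\det_q$. -/

import Mathlib

open scoped TensorProduct

noncomputable section

universe u v

/-! ### Braidings on bialgebras and normal elements -/

/-- A braiding on a bialgebra `A`: a bilinear pairing `⟨a | b⟩ = β (a ⊗ b)`, invertible for the
convolution product of `(A ⊗ A)^*`, subject to
* `∑ ⟨a₁ | b₁⟩ b₂ a₂ = ∑ ⟨a₂ | b₂⟩ a₁ b₁`,
* `⟨a | b c⟩ = ∑ ⟨a₁ | b⟩ ⟨a₂ | c⟩`,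
* `⟨a b | c⟩ = ∑ ⟨b | c₁⟩ ⟨a | c₂⟩`,

where `∑ a₁ ⊗ a₂` is any way of writing the coproduct of `a` as a finite sum. -/
structure IsBraiding {k : Type v} {A : Type u} [Field k] [Ring A] [Bialgebra k A]
    (β : A ⊗[k] A →ₗ[k] k) : Prop where
  comm : ∀ (a b : A) {ι κ : Type u} (r : Coalgebra.Repr k a ι) (s : Coalgebra.Repr k b κ),
    ∑ x ∈ r.index, ∑ y ∈ s.index,
        β (r.left x ⊗ₜ[k] s.left y) • (s.right y * r.right x) =
      ∑ x ∈ r.index, ∑ y ∈ s.index,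
        β (r.right x ⊗ₜ[k] s.right y) • (r.left x * s.left y)
  invertible : IsUnit (WithConv.toConv β)
  mul_right : ∀ (a b c : A) {ι : Type u} (r : Coalgebra.Repr k a ι),
    β (a ⊗ₜ[k] (b * c)) =
      ∑ x ∈ r.index, β (r.left x ⊗ₜ[k] b) * β (r.right x ⊗ₜ[k] c)
  mul_left : ∀ (a b c : A) {ι : Type u} (s : Coalgebra.Repr k c ι),
    β ((a * b) ⊗ₜ[k] c) =
      ∑ x ∈ s.index, β (b ⊗ₜ[k] s.left x) * β (a ⊗ₜ[k] s.right x)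

/-- An element `d` of a ring `A` is normal if `d A = A d`. -/
def IsNormalElem {A : Type u} [Ring A] (d : A) : Prop :=
  Set.range (fun a : A => d * a) = Set.range (fun a : A => a * d)

/-! ### The bialgebra `A(R)`

A matrix `R` acting on `V ⊗ V`, where `V` has basis `e_i` (`i : Fin n`), is given by its entries
`R i j k l = R_{ij}^{kl}`, so that `R (e_i ⊗ e_j) = ∑ R_{ij}^{kl} e_k ⊗ e_l`. -/

section FRT

variable {k : Type v} [Field k] {n : ℕ}

/-- The relations
`∑_{u,v} R_{ji}^{uv} T_u^a T_v^b = ∑_{u,v} R_{vu}^{ab} T_i^u T_j^v`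
between free generators; the generator `T_i^a` is indexed by the pair `(i, a)`. -/
inductive FRTRel (R : Fin n → Fin n → Fin n → Fin n → k) :
    FreeAlgebra k (Fin n × Fin n) → FreeAlgebra k (Fin n × Fin n) → Prop
  | rel (i j a b : Fin n) : FRTRel R
      (∑ u, ∑ v, R j i u v • (FreeAlgebra.ι k (u, a) * FreeAlgebra.ι k (v, b)))
      (∑ u, ∑ v, R v u a b • (FreeAlgebra.ι k (i, u) * FreeAlgebra.ι k (j, v)))

/-- The algebra `A(R)`. -/
def FRTAlgebra (R : Fin n → Fin n → Fin n → Fin n → k) : Type v := RingQuot (FRTRel R)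

namespace FRTAlgebra

variable (R : Fin n → Fin n → Fin n → Fin n → k)

instance instRing : Ring (FRTAlgebra R) := inferInstanceAs (Ring (RingQuot (FRTRel R)))

instance instAlgebra : Algebra k (FRTAlgebra R) :=
  inferInstanceAs (Algebra k (RingQuot (FRTRel R)))

/-- The quotient map from the free algebra. -/
def mk : FreeAlgebra k (Fin n × Fin n) →ₐ[k] FRTAlgebra R :=
  RingQuot.mkAlgHom k (FRTRel R)

/-- The standard generator `T_i^a` of `A(R)`. -/
def T (i a : Fin n) : FRTAlgebra R := mk R (FreeAlgebra.ι k (i, a))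

theorem rtt (i j a b : Fin n) :
    ∑ u, ∑ v, R j i u v • (T R u a * T R v b) =
      ∑ u, ∑ v, R v u a b • (T R i u * T R j v) := by
  have h : mk R _ = mk R _ := RingQuot.mkAlgHom_rel k (FRTRel.rel (R := R) i j a b)
  simpa [T, map_sum] using h

/-- An assignment of the generators that respects the relations induces an algebra map. -/
def lift {B : Type*} [Semiring B] [Algebra k B] (f : Fin n → Fin n → B)
    (hf : ∀ i j a b, ∑ u, ∑ v, R j i u v • (f u a * f v b) =
      ∑ u, ∑ v, R v u a b • (f i u * f j v)) : FRTAlgebra R →ₐ[k] B :=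
  RingQuot.liftAlgHom k ⟨FreeAlgebra.lift k fun x => f x.1 x.2, by
    rintro _ _ ⟨i, j, a, b⟩
    simpa [map_sum] using hf i j a b⟩

@[simp] theorem lift_T {B : Type*} [Semiring B] [Algebra k B] (f : Fin n → Fin n → B)
    (hf : ∀ i j a b, ∑ u, ∑ v, R j i u v • (f u a * f v b) =
      ∑ u, ∑ v, R v u a b • (f i u * f j v)) (i a : Fin n) :
    lift R f hf (T R i a) = f i a := by
  unfold lift T mk
  erw [RingQuot.liftAlgHom_mkAlgHom_apply]
  simp

theorem hom_ext {B : Type*} [Semiring B] [Algebra k B] {f g : FRTAlgebra R →ₐ[k] B}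
    (h : ∀ i a, f (T R i a) = g (T R i a)) : f = g := by
  apply RingQuot.ringQuot_ext'
  apply FreeAlgebra.hom_ext
  funext x
  exact h x.1 x.2

theorem sum_comm_four {M : Type*} [AddCommMonoid M] (f : Fin n → Fin n → Fin n → Fin n → M) :
    ∑ u, ∑ v, ∑ s, ∑ t, f u v s t = ∑ s, ∑ t, ∑ u, ∑ v, f u v s t := by
  calc _ = ∑ u, ∑ s, ∑ v, ∑ t, f u v s t :=
        Finset.sum_congr rfl fun u _ => Finset.sum_comm
    _ = ∑ s, ∑ u, ∑ v, ∑ t, f u v s t := Finset.sum_comm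
    _ = ∑ s, ∑ u, ∑ t, ∑ v, f u v s t :=
        Finset.sum_congr rfl fun s _ => Finset.sum_congr rfl fun u _ => Finset.sum_comm
    _ = _ := Finset.sum_congr rfl fun s _ => Finset.sum_comm

/-- The coproduct `T_i^a ↦ ∑_m T_i^m ⊗ T_m^a`. -/
def comulHom : FRTAlgebra R →ₐ[k] FRTAlgebra R ⊗[k] FRTAlgebra R :=
  lift R (fun i a => ∑ m, T R i m ⊗ₜ[k] T R m a) (by
    intro i j a b
    have h1 : ∀ u a v b : Fin n,
        (∑ m, T R u m ⊗ₜ[k] T R m a) * (∑ m, T R v m ⊗ₜ[k] T R m b) =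
        ∑ s, ∑ t, (T R u s * T R v t) ⊗ₜ[k] (T R s a * T R t b) := by
      intro u a v b
      simp [Finset.sum_mul_sum]
    simp only [h1]
    calc _ = ∑ s, ∑ t, (∑ u, ∑ v, R j i u v • (T R u s * T R v t)) ⊗ₜ[k]
              (T R s a * T R t b) := by
            simp only [TensorProduct.sum_tmul, Finset.smul_sum, TensorProduct.smul_tmul']
            exact sum_comm_four _
      _ = ∑ s, ∑ t, (∑ u, ∑ v, R v u s t • (T R i u * T R j v)) ⊗ₜ[k]
              (T R s a * T R t b) := by
            simp only [rtt]
      _ = ∑ u, ∑ v, (T R i u * T R j v) ⊗ₜ[k]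
              (∑ s, ∑ t, R v u s t • (T R s a * T R t b)) := by
            simp only [TensorProduct.sum_tmul, TensorProduct.tmul_sum,
              TensorProduct.smul_tmul', TensorProduct.tmul_smul]
            exact sum_comm_four _
      _ = ∑ u, ∑ v, (T R i u * T R j v) ⊗ₜ[k]
              (∑ s, ∑ t, R t s a b • (T R u s * T R v t)) := by
            simp only [rtt]
      _ = _ := by
            simp only [TensorProduct.tmul_sum, Finset.smul_sum, TensorProduct.tmul_smul]
            exact sum_comm_four _)

/-- The counit `T_i^a ↦ δ_{ia}`. -/
def counitHom : FRTAlgebra R →ₐ[k] k :=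
  lift R (fun i a => if i = a then 1 else 0) (by
    intro i j a b
    simp)

instance instBialgebra : Bialgebra k (FRTAlgebra R) :=
  Bialgebra.ofAlgHom (comulHom R) (counitHom R)
    (by
      apply hom_ext
      intro i a
      simp [comulHom, TensorProduct.sum_tmul, TensorProduct.tmul_sum]
      exact Finset.sum_comm)
    (by
      apply hom_ext
      intro i a
      simp [comulHom, counitHom, TensorProduct.ite_tmul])
    (by
      apply hom_ext
      intro i a
      simp [comulHom, counitHom, TensorProduct.tmul_ite])

end FRTAlgebra

end FRT

/-! ### The Cremmer-Gervais `R`-matrix and its exterior algebra -/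

/-- The entries `R_{ij}^{kl}` of the two-parameter Cremmer-Gervais matrix `R_n(q,p)`:
`p R_{ij}^{kl}` is
* `q p^{2(l-i)}` if `i = k ≥ j = l`,
* `q⁻¹ p^{2(l-i)}` if `i = k < j = l`,
* `(q - q⁻¹) p^{2(l-i)}` if `j ≤ k < i` and `i + j = k + l`,
* `(q⁻¹ - q) p^{2(l-i)}` if `i < k < j` and `i + j = k + l`,

and `0` otherwise. Only differences of indices matter, so indices may start at `0`. -/
def cremmerGervais (n : ℕ) (q p : ℂ) (i j k l : Fin n) : ℂ :=
  p⁻¹ *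
    if i = k ∧ j = l ∧ j ≤ i then q * p ^ (2 * ((l : ℤ) - (i : ℤ)))
    else if i = k ∧ j = l ∧ i < j then q⁻¹ * p ^ (2 * ((l : ℤ) - (i : ℤ)))
    else if j ≤ k ∧ k < i ∧ (i : ℕ) + j = k + l then
      (q - q⁻¹) * p ^ (2 * ((l : ℤ) - (i : ℤ)))
    else if i < k ∧ k < j ∧ (i : ℕ) + j = k + l then
      (q⁻¹ - q) * p ^ (2 * ((l : ℤ) - (i : ℤ)))
    else 0

/-- The bialgebra `A(R)` for `R = R_n(q,p)`. -/
abbrev CGAlgebra (n : ℕ) (q p : ℂ) : Type := FRTAlgebra (cremmerGervais n q p)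

/-- The generator `T_i^a` of `A(R)` for `R = R_n(q,p)`. -/
abbrev CGAlgebra.T (n : ℕ) (q p : ℂ) (i a : Fin n) : CGAlgebra n q p :=
  FRTAlgebra.T (cremmerGervais n q p) i a

/-- The relations `q⁻¹ x_j x_i + ∑_{k,l} p R_{ij}^{kl} x_k x_l = 0` of `Λ(R)`. -/
inductive CGExteriorRel (n : ℕ) (q p : ℂ) :
    FreeAlgebra ℂ (Fin n) → FreeAlgebra ℂ (Fin n) → Prop
  | rel (i j : Fin n) : CGExteriorRel n q p
      (q⁻¹ • (FreeAlgebra.ι ℂ j * FreeAlgebra.ι ℂ i) +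
        ∑ k, ∑ l, (p * cremmerGervais n q p i j k l) •
          (FreeAlgebra.ι ℂ k * FreeAlgebra.ι ℂ l)) 0

/-- The exterior algebra `Λ(R)` for `R = R_n(q,p)`. -/
def CGExterior (n : ℕ) (q p : ℂ) : Type := RingQuot (CGExteriorRel n q p)

namespace CGExterior

variable (n : ℕ) (q p : ℂ)

instance instRing : Ring (CGExterior n q p) :=
  inferInstanceAs (Ring (RingQuot (CGExteriorRel n q p)))

instance instAlgebra : Algebra ℂ (CGExterior n q p) :=
  inferInstanceAs (Algebra ℂ (RingQuot (CGExteriorRel n q p)))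

/-- The quotient map from the free algebra. -/
def mk : FreeAlgebra ℂ (Fin n) →ₐ[ℂ] CGExterior n q p :=
  RingQuot.mkAlgHom ℂ (CGExteriorRel n q p)

/-- The generator `x_i` of `Λ(R)`. -/
def x (i : Fin n) : CGExterior n q p := mk n q p (FreeAlgebra.ι ℂ i)

theorem x_rel (i j : Fin n) :
    q⁻¹ • (x n q p j * x n q p i) +
      ∑ k, ∑ l, (p * cremmerGervais n q p i j k l) • (x n q p k * x n q p l) = 0 := by
  have h : mk n q p _ = mk n q p _ :=
    RingQuot.mkAlgHom_rel ℂ (CGExteriorRel.rel (n := n) (q := q) (p := p) i j)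
  simpa [x, map_sum] using h

/-- The product `x_{f 1} x_{f 2} ⋯ x_{f n}`. -/
def prodX (f : Fin n → Fin n) : CGExterior n q p :=
  (List.ofFn fun i => x n q p (f i)).prod

/-- The top form `x_1 x_2 ⋯ x_n`. -/
def top : CGExterior n q p := prodX n q p id

/-- The comodule structure `ρ : Λ(R) → A(R) ⊗ Λ(R)`, the algebra map with
`ρ(x_i) = ∑_j T_i^j ⊗ x_j`. -/
def coaction : CGExterior n q p →ₐ[ℂ] CGAlgebra n q p ⊗[ℂ] CGExterior n q p :=
  RingQuot.liftAlgHom ℂ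
    ⟨FreeAlgebra.lift ℂ fun i => ∑ j, CGAlgebra.T n q p i j ⊗ₜ[ℂ] x n q p j, by
      rintro _ _ ⟨i, j⟩
      have h1 : ∀ u v : Fin n,
          (∑ c, CGAlgebra.T n q p u c ⊗ₜ[ℂ] x n q p c) *
            (∑ c, CGAlgebra.T n q p v c ⊗ₜ[ℂ] x n q p c) =
          ∑ s, ∑ t, (CGAlgebra.T n q p u s * CGAlgebra.T n q p v t) ⊗ₜ[ℂ]
            (x n q p s * x n q p t) := by
        intro u v
        simp [Finset.sum_mul_sum]
      have h2 : ∑ k, ∑ l, (p * cremmerGervais n q p i j k l) •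
          ∑ s, ∑ t, (CGAlgebra.T n q p k s * CGAlgebra.T n q p l t) ⊗ₜ[ℂ]
            (x n q p s * x n q p t) =
          ∑ u, ∑ v, (CGAlgebra.T n q p j u * CGAlgebra.T n q p i v) ⊗ₜ[ℂ]
            (∑ s, ∑ t, (p * cremmerGervais n q p v u s t) •
              (x n q p s * x n q p t)) := by
        calc _ = ∑ s, ∑ t, (p • ∑ k, ∑ l, cremmerGervais n q p i j k l •
                (CGAlgebra.T n q p k s * CGAlgebra.T n q p l t)) ⊗ₜ[ℂ]
                (x n q p s * x n q p t) := by
              simp only [TensorProduct.sum_tmul, Finset.smul_sum, TensorProduct.smul_tmul',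
                smul_smul]
              exact FRTAlgebra.sum_comm_four _
          _ = ∑ s, ∑ t, (p • ∑ u, ∑ v, cremmerGervais n q p v u s t •
                (CGAlgebra.T n q p j u * CGAlgebra.T n q p i v)) ⊗ₜ[ℂ]
                (x n q p s * x n q p t) := by
              simp only [FRTAlgebra.rtt]
          _ = _ := by
              simp only [TensorProduct.sum_tmul, TensorProduct.tmul_sum, Finset.smul_sum,
                TensorProduct.smul_tmul', TensorProduct.tmul_smul, smul_smul]
              exact FRTAlgebra.sum_comm_four _
      simp only [map_add, map_sum, map_smul, map_mul, FreeAlgebra.lift_ι_apply, map_zero, h1, h2]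
      rw [Finset.smul_sum, ← Finset.sum_add_distrib]
      refine Finset.sum_eq_zero fun u _ => ?_
      rw [Finset.smul_sum, ← Finset.sum_add_distrib]
      refine Finset.sum_eq_zero fun v _ => ?_
      rw [← TensorProduct.tmul_smul, ← TensorProduct.tmul_add, x_rel, TensorProduct.tmul_zero]⟩

theorem coaction_x (i : Fin n) :
    coaction n q p (x n q p i) = ∑ j, CGAlgebra.T n q p i j ⊗ₜ[ℂ] x n q p j := by
  unfold coaction x mk
  erw [RingQuot.liftAlgHom_mkAlgHom_apply]
  simp

end CGExterior

/-- `β` is the braiding `⟨ | ⟩` of `A(R)`: a braiding with `⟨T_i^k | T_j^l⟩ = R_{ji}^{lk}`. -/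
def IsCGBraiding (n : ℕ) (q p : ℂ)
    (β : CGAlgebra n q p ⊗[ℂ] CGAlgebra n q p →ₗ[ℂ] ℂ) : Prop :=
  IsBraiding β ∧ ∀ i k j l : Fin n,
    β (CGAlgebra.T n q p i k ⊗ₜ[ℂ] CGAlgebra.T n q p j l) = cremmerGervais n q p j i l k

/-- `d` is the quantum determinant `det_q`: `ρ(x_1 ⋯ x_n) = d ⊗ x_1 ⋯ x_n`. -/
def IsQuantumDet (n : ℕ) (q p : ℂ) (d : CGAlgebra n q p) : Prop :=
  CGExterior.coaction n q p (CGExterior.top n q p) = d ⊗ₜ[ℂ] CGExterior.top n q p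

end

/-! Pairings. The two product axioms say that `b ↦ ⟨· | b⟩` is a homomorphism, and `a ↦ ⟨a | ·⟩` an
antihomomorphism, to the convolution algebra `A^*`. Hence a braiding on `A(R)` is determined by its
values on generators (`pairing_ext`). It exists once the matrix satisfies the Yang–Baxter equations
of `MixedYangBaxter`. The commutation axiom and invertibility survive products, so they are checked
on generators, where they become the RTT relation and the invertibility of `R_21`
(`existsUnique_braiding`). The convolution inverse is the pairing built from `S = R_21⁻¹` with its
arguments swapped, so the Yang–Baxter equations are needed for the two matrices `R` and `S`
together.

Yang–Baxter. Read `e_i ⊗ e_j` as the monomial `x^i y^j`. For `p = 1` the matrix acts as `f ↦ q f +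
(q - q⁻¹) y (f(x,y) - f(y,x)) / (x - y)` (`sum_cremmerGervais_mul`), so the equations become
identities of rational functions in three variables. General `p` follows because nonzero entries
preserve `i + j`, which makes the powers of `p` factor out (`mixedYangBaxter_twist`).

Determinant. When `q² ≠ -1` the relations of `Λ(R)` amount to `x_i² = 0` and `x_j x_i = -p^{2(j-i)}
x_i x_j` for `i < j`. So words with a repeated letter vanish and rearrangements of the top form are
multiples of it. The top form is nonzero because `Λ(R)` acts by twisted wedge operators built on the
ordinary exterior algebra (`top_ne_zero`). Expanding `ρ(x_1 ⋯ x_n)` gives the formula for the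
determinant, and coassociativity of `ρ` makes it group-like.

Values. To find `⟨det_q | T_s^t⟩`, write the top form with its letters ordered by decreasing
distance from `s`, and contract. An off-diagonal entry of `R` replaces a letter by one strictly
closer to `s`, which occurs again further right and kills the word. Only the product of the entries
`R_{sj}^{sj}` remains (`pairContractRight_word`); the other side is symmetric. Putting `T_i^k` and
the group-like `det_q` into the commutation axiom then gives the commutation rule, and normality
follows. -/

/-! ### Multiplicative pairings and convolution -/

section Pairing

open WithConv Coalgebra

variable {k A : Type*} [Field k] [Ring A] [Bialgebra k A]

/-- The functional `⟨· | b⟩`, as an element of the convolution algebra `A^*`. -/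
noncomputable def pairingRight (β : A ⊗[k] A →ₗ[k] k) : A →ₗ[k] WithConv (A →ₗ[k] k) :=
  (WithConv.linearEquiv k (A →ₗ[k] k)).symm.toLinearMap ∘ₗ (TensorProduct.curry β).flip

/-- The functional `⟨a | ·⟩`, as an element of the convolution algebra `A^*`. -/
noncomputable def pairingLeft (β : A ⊗[k] A →ₗ[k] k) : A →ₗ[k] WithConv (A →ₗ[k] k) :=
  (WithConv.linearEquiv k (A →ₗ[k] k)).symm.toLinearMap ∘ₗ (TensorProduct.curry β)

@[simp] theorem pairingRight_apply (β : A ⊗[k] A →ₗ[k] k) (a b : A) :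
    (pairingRight β b).ofConv a = β (a ⊗ₜ b) := rfl

@[simp] theorem pairingLeft_apply (β : A ⊗[k] A →ₗ[k] k) (a b : A) :
    (pairingLeft β a).ofConv b = β (a ⊗ₜ b) := rfl

/-- A bilinear pairing that is multiplicative in the second and antimultiplicative in the first
variable. -/
structure IsMulPairing (β : A ⊗[k] A →ₗ[k] k) : Prop where
  one_right : pairingRight β 1 = 1
  one_left : pairingLeft β 1 = 1
  mul_right : ∀ b c, pairingRight β (b * c) = pairingRight β b * pairingRight β c
  mul_left : ∀ a b, pairingLeft β (a * b) = pairingLeft β b * pairingLeft β a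

/-- `b ↦ ⟨· | b⟩` as a homomorphism to the convolution algebra. -/
noncomputable def IsMulPairing.rightHom {β : A ⊗[k] A →ₗ[k] k} (h : IsMulPairing β) :
    A →ₐ[k] WithConv (A →ₗ[k] k) :=
  AlgHom.ofLinearMap (pairingRight β) h.one_right h.mul_right

/-! ### Convolution algebras: change of coalgebra, scalar-valued and constant maps. -/

section Conv

variable {C D B : Type*} [AddCommGroup C] [Module k C] [Coalgebra k C]
  [AddCommGroup D] [Module k D] [Coalgebra k D] [Ring B] [Algebra k B]

/-- Precomposition with a coalgebra map is a homomorphism of convolution algebras. -/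
noncomputable def convPrecomp (φ : C →ₗc[k] D) :
    WithConv (D →ₗ[k] B) →ₐ[k] WithConv (C →ₗ[k] B) :=
  AlgHom.ofLinearMap
    { toFun := fun f => toConv (f.ofConv ∘ₗ φ.toLinearMap)
      map_add' := fun f g => rfl
      map_smul' := fun c f => rfl }
    (by
      apply WithConv.ext
      ext x
      simp [LinearMap.convOne_def])
    (fun f g => by
      apply WithConv.ext
      exact LinearMap.convMul_comp_coalgHom_distrib f g φ)

@[simp] theorem convPrecomp_apply (φ : C →ₗc[k] D) (f : WithConv (D →ₗ[k] B)) (c : C) :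
    (convPrecomp φ f).ofConv c = f.ofConv (φ c) := rfl

/-- Functionals as maps with values in the scalars of an algebra. -/
noncomputable def convOfScalar :
    WithConv (C →ₗ[k] k) →ₐ[k] WithConv (C →ₗ[k] B) :=
  AlgHom.ofLinearMap
    { toFun := fun f => toConv (Algebra.linearMap k B ∘ₗ f.ofConv)
      map_add' := fun f g => by
        apply WithConv.ext
        ext x
        simp
      map_smul' := fun c f => by
        apply WithConv.ext
        exact LinearMap.comp_smul _ c f.ofConv }
    (by
      apply WithConv.ext
      ext x
      simp [LinearMap.convOne_def])
    (fun f g => by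
      apply WithConv.ext
      exact LinearMap.algHom_comp_convMul_distrib (Algebra.ofId k B) f g)

@[simp] theorem convOfScalar_apply (f : WithConv (C →ₗ[k] k)) (c : C) :
    (convOfScalar (k := k) (C := C) (B := B) f).ofConv c = algebraMap k B (f.ofConv c) := rfl

theorem conv_mul_apply {ι : Type*} {c : C} (r : Coalgebra.Repr k c ι) (f g : WithConv (C →ₗ[k] B)) :
    (f * g).ofConv c = ∑ i ∈ r.index, f.ofConv (r.left i) * g.ofConv (r.right i) :=
  r.convMul_apply f g

theorem conv_one_apply (c : C) :
    (1 : WithConv (C →ₗ[k] B)).ofConv c = algebraMap k B (counit (R := k) c) := rfl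

/-- Constant maps `c ↦ ε(c) b`. -/
noncomputable def convConst : B →ₐ[k] WithConv (C →ₗ[k] B) :=
  AlgHom.ofLinearMap
    { toFun := fun b => toConv ((counit (R := k) (A := C)).smulRight b)
      map_add' := fun f g => by
        apply WithConv.ext
        ext x
        simp
      map_smul' := fun c f => by
        apply WithConv.ext
        ext x
        exact smul_comm _ _ _ }
    (by
      apply WithConv.ext
      ext x
      simp [LinearMap.convOne_def, Algebra.algebraMap_eq_smul_one])
    (fun f g => by
      apply WithConv.ext
      ext x
      rw [conv_mul_apply (ℛ k x)]
      have h := congrArg (counit (R := k)) (Coalgebra.sum_counit_smul (ℛ k x))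
      simp only [map_sum, map_smul, smul_eq_mul] at h
      simp only [LinearMap.coe_mk, AddHom.coe_mk, ofConv_toConv, LinearMap.smulRight_apply,
        smul_mul_smul_comm, ← Finset.sum_smul, h])

@[simp] theorem convConst_apply (b : B) (c : C) :
    (convConst (k := k) b).ofConv c = counit (R := k) c • b := rfl

theorem convConst_mul_apply (b : B) (f : WithConv (C →ₗ[k] B)) (c : C) :
    (convConst b * f).ofConv c = b * f.ofConv c := by
  rw [conv_mul_apply (ℛ k c)]
  conv_rhs => rw [← Coalgebra.sum_counit_smul (ℛ k c)]
  simp [Finset.mul_sum]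

theorem mul_convConst_apply (b : B) (f : WithConv (C →ₗ[k] B)) (c : C) :
    (f * convConst b).ofConv c = f.ofConv c * b := by
  rw [conv_mul_apply (ℛ k c)]
  have h : ∑ i ∈ (ℛ k c).index, counit (R := k) ((ℛ k c).right i) • (ℛ k c).left i = c := by
    have := congrArg (TensorProduct.rid k C) (Coalgebra.sum_tmul_counit_eq (ℛ k c))
    simpa only [map_sum, TensorProduct.rid_tmul, one_smul] using this
  conv_rhs => rw [← h]
  simp [Finset.sum_mul]

/-- Scalars are central in `B`, and convolving with a constant is just multiplication by it. This
commutation allows the two homomorphisms to be combined into one on a tensor product. -/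
theorem convOfScalar_commute_convConst (f : WithConv (C →ₗ[k] k)) (b : B) :
    Commute (convOfScalar (k := k) (C := C) (B := B) f) (convConst b) := by
  apply WithConv.ext
  ext c
  rw [mul_convConst_apply, convConst_mul_apply, convOfScalar_apply, Algebra.commutes]

end Conv

end Pairing

/-! ### Constructing a pairing on `A(R)` from Yang–Baxter type equations. -/

namespace FRTAlgebra

open WithConv Coalgebra

variable {k : Type*} [Field k] {n : ℕ} {R : Fin n → Fin n → Fin n → Fin n → k}

theorem comul_T (i a : Fin n) :
    comul (R := k) (T R i a) = ∑ m, T R i m ⊗ₜ[k] T R m a := by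
  change comulHom R (T R i a) = _
  simp [comulHom]

theorem counit_T (i a : Fin n) :
    counit (R := k) (T R i a) = if i = a then 1 else 0 := by
  change counitHom R (T R i a) = _
  simp [counitHom]

/-- The defining representation of the coproduct of a generator. -/
noncomputable def reprT (R : Fin n → Fin n → Fin n → Fin n → k) (i a : Fin n) :
    Coalgebra.Repr k (T R i a) (Fin n) where
  index := Finset.univ
  left m := T R i m
  right m := T R m a
  eq := (comul_T i a).symm

theorem induction {P : FRTAlgebra R → Prop} (halg : ∀ c : k, P (algebraMap k _ c))
    (hT : ∀ i a, P (T R i a)) (hadd : ∀ x y, P x → P y → P (x + y))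
    (hmul : ∀ x y, P x → P y → P (x * y)) (x : FRTAlgebra R) : P x := by
  obtain ⟨y, rfl⟩ := RingQuot.mkAlgHom_surjective k (FRTRel R) x
  induction y using FreeAlgebra.induction with
  | grade0 c => rw [AlgHom.commutes]; exact halg c
  | grade1 x => exact hT x.1 x.2
  | mul a b ha hb => rw [map_mul]; exact hmul _ _ ha hb
  | add a b ha hb => rw [map_add]; exact hadd _ _ ha hb

section Existence

variable (R) (S : Fin n → Fin n → Fin n → Fin n → k)

/-- The Yang–Baxter type conditions under which the entries of `S` define a pairing on `A(R)`. -/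
structure MixedYangBaxter : Prop where
  left : ∀ s j i t a b, ∑ u, ∑ v, ∑ m, R j i u v * S s v m b * S m u t a =
    ∑ u, ∑ v, ∑ m, R v u a b * S s j m v * S m i t u
  right : ∀ i j a b c d, ∑ u, ∑ v, ∑ m, R j i u v * S u c a m * S v m b d =
    ∑ u, ∑ v, ∑ m, R v u a b * S i c u m * S j m v d

variable {R S}

/-- The representation of `A(R)` by the matrices `(S_{s i}^{t a})_{s t}`, which reverses
products. -/
noncomputable def matrixRep (h : MixedYangBaxter R S) :
    FRTAlgebra R →ₐ[k] (Matrix (Fin n) (Fin n) k)ᵐᵒᵖ :=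
  lift R (fun i a => MulOpposite.op (Matrix.of fun s t => S s i t a)) (by
    intro i j a b
    apply MulOpposite.unop_injective
    ext s t
    have := h.left s j i t a b
    simpa [Matrix.sum_apply, Matrix.mul_apply, Finset.mul_sum, mul_assoc] using this)

/-- The matrix coefficients of `matrixRep`. -/
noncomputable def coef (h : MixedYangBaxter R S) (s t : Fin n) : FRTAlgebra R →ₗ[k] k :=
  Matrix.entryLinearMap k k s t ∘ₗ (MulOpposite.opLinearEquiv k).symm.toLinearMap ∘ₗ
    (matrixRep h).toLinearMap

theorem coef_T (h : MixedYangBaxter R S) (s t i a : Fin n) : coef h s t (T R i a) = S s i t a := by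
  simp [coef, matrixRep]

theorem coef_one (h : MixedYangBaxter R S) (s t : Fin n) :
    coef h s t 1 = if s = t then 1 else 0 := by
  simp [coef, Matrix.one_apply]

theorem coef_mul (h : MixedYangBaxter R S) (s t : Fin n) (x y : FRTAlgebra R) :
    coef h s t (x * y) = ∑ m, coef h s m y * coef h m t x := by
  simp [coef, Matrix.mul_apply]

/-- The matrix of the tensor products of two matrix coefficients. -/
noncomputable def coefSq (h : MixedYangBaxter R S) :
    FRTAlgebra R ⊗[k] FRTAlgebra R →ₗ[k] Matrix (Fin n × Fin n) (Fin n × Fin n) k :=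
  LinearMap.pi fun s => LinearMap.pi fun t =>
    LinearMap.mul' k k ∘ₗ TensorProduct.map (coef h s.1 t.1) (coef h s.2 t.2)

theorem coefSq_tmul (h : MixedYangBaxter R S) (x y : FRTAlgebra R) (s t : Fin n × Fin n) :
    coefSq h (x ⊗ₜ y) s t = coef h s.1 t.1 x * coef h s.2 t.2 y := rfl

theorem coefSq_mul (h : MixedYangBaxter R S) (z w : FRTAlgebra R ⊗[k] FRTAlgebra R) :
    coefSq h (z * w) = coefSq h w * coefSq h z := by
  induction z using TensorProduct.induction_on with
  | zero => simp
  | add a b ha hb => rw [add_mul, map_add, ha, hb, map_add, mul_add]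
  | tmul x y =>
    induction w using TensorProduct.induction_on with
    | zero => simp
    | add a b ha hb => rw [mul_add, map_add, ha, hb, map_add, add_mul]
    | tmul x' y' =>
      ext s t
      rw [Algebra.TensorProduct.tmul_mul_tmul, coefSq_tmul, coef_mul, coef_mul,
        Matrix.mul_apply, Finset.sum_mul_sum, Fintype.sum_prod_type]
      simp only [coefSq_tmul]
      refine Finset.sum_congr rfl fun _ _ => Finset.sum_congr rfl fun _ _ => ?_
      ring

/-- On generators this is the second Yang–Baxter equation. Since `coefSq ∘ comul` reverses products,
commuting with a fixed matrix passes to products. It is the RTT relation for the functionals `coef`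
in the convolution algebra. -/
theorem coefSq_comul_commute (h : MixedYangBaxter R S) (x : FRTAlgebra R) :
    Commute (Matrix.of fun s t : Fin n × Fin n => R s.2 s.1 t.1 t.2) (coefSq h (comul x)) := by
  induction x using FRTAlgebra.induction with
  | halg c =>
    rw [Algebra.algebraMap_eq_smul_one, map_smul, map_smul]
    refine Commute.smul_right ?_ c
    have : coefSq h (comul (1 : FRTAlgebra R)) = 1 := by
      ext s t
      rw [Bialgebra.comul_one, Algebra.TensorProduct.one_def, coefSq_tmul, coef_one, coef_one,
        Matrix.one_apply]
      simp only [Prod.ext_iff]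
      split_ifs <;> simp_all
    rw [this]
    exact Commute.one_right _
  | hT c d =>
    ext ⟨i, j⟩ ⟨a, b⟩
    have := h.right i j a b c d
    rw [comul_T, map_sum, Matrix.mul_apply, Matrix.mul_apply, Fintype.sum_prod_type,
      Fintype.sum_prod_type]
    simp only [Matrix.of_apply, Matrix.sum_apply, coefSq_tmul, coef_T, Finset.mul_sum,
      Finset.sum_mul]
    simp only [mul_assoc] at this
    rw [this]
    refine Finset.sum_congr rfl fun _ _ => Finset.sum_congr rfl fun _ _ =>
      Finset.sum_congr rfl fun _ _ => ?_
    ring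
  | hadd x y hx hy => rw [map_add, map_add]; exact hx.add_right hy
  | hmul x y hx hy => rw [Bialgebra.comul_mul, coefSq_mul]; exact hy.mul_right hx

theorem conv_coef_mul_apply (h : MixedYangBaxter R S) (s t s' t' : Fin n) (x : FRTAlgebra R) :
    (toConv (coef h s t) * toConv (coef h s' t')).ofConv x =
      coefSq h (comul x) (s, s') (t, t') := rfl

/-- The homomorphism `b ↦ ⟨· | b⟩` to the convolution algebra. -/
noncomputable def pairingHom (h : MixedYangBaxter R S) :
    FRTAlgebra R →ₐ[k] WithConv (FRTAlgebra R →ₗ[k] k) :=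
  lift R (fun s t => toConv (coef h s t)) (by
    intro i j a b
    apply WithConv.ext
    ext x
    have := congrFun (congrFun (coefSq_comul_commute h x).eq (i, j)) (a, b)
    rw [Matrix.mul_apply, Matrix.mul_apply, Fintype.sum_prod_type, Fintype.sum_prod_type] at this
    simp only [Matrix.of_apply] at this
    simp only [ofConv_sum, LinearMap.sum_apply, ofConv_smul, LinearMap.smul_apply,
      conv_coef_mul_apply, smul_eq_mul]
    rw [this]
    refine Finset.sum_congr rfl fun _ _ => Finset.sum_congr rfl fun _ _ => mul_comm _ _)

theorem pairingHom_T (h : MixedYangBaxter R S) (s t : Fin n) :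
    pairingHom h (T R s t) = toConv (coef h s t) := lift_T _ _ _ _ _

/-- The pairing on `A(R)` defined by `S`. -/
noncomputable def pairing (h : MixedYangBaxter R S) :
    FRTAlgebra R ⊗[k] FRTAlgebra R →ₗ[k] k :=
  TensorProduct.lift
    ((WithConv.linearEquiv k (FRTAlgebra R →ₗ[k] k)).toLinearMap ∘ₗ
      (pairingHom h).toLinearMap).flip

theorem pairing_tmul (h : MixedYangBaxter R S) (a b : FRTAlgebra R) :
    pairing h (a ⊗ₜ b) = (pairingHom h b).ofConv a := rfl

theorem pairing_T_right (h : MixedYangBaxter R S) (a : FRTAlgebra R) (s t : Fin n) :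
    pairing h (a ⊗ₜ T R s t) = coef h s t a := by
  rw [pairing_tmul, pairingHom_T]

theorem pairing_T_T (h : MixedYangBaxter R S) (i a j l : Fin n) :
    pairing h (T R i a ⊗ₜ T R j l) = S j i l a := by
  rw [pairing_T_right, coef_T]

end Existence

end FRTAlgebra

/-! ### Antimultiplicativity of the constructed pairing in its first variable. -/

section Projections

open WithConv Coalgebra

variable {k A : Type*} [Field k] [Ring A] [Bialgebra k A]

/-- `a ⊗ b ↦ ε(b) a`. -/
noncomputable def projLeft : A ⊗[k] A →ₗc[k] A :=
  (Coalgebra.TensorProduct.rid k k A).toCoalgHom.comp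
    (Coalgebra.TensorProduct.map (CoalgHom.id k A) (counitCoalgHom k A))

/-- `a ⊗ b ↦ ε(a) b`. -/
noncomputable def projRight : A ⊗[k] A →ₗc[k] A :=
  (Coalgebra.TensorProduct.lid k A).toCoalgHom.comp
    (Coalgebra.TensorProduct.map (counitCoalgHom k A) (CoalgHom.id k A))

theorem projLeft_tmul (a b : A) : projLeft (a ⊗ₜ[k] b) = counit (R := k) b • a := rfl

theorem projRight_tmul (a b : A) : projRight (a ⊗ₜ[k] b) = counit (R := k) a • b := rfl

theorem sum_smul_counit (a : A) :
    ∑ i ∈ (ℛ k a).index, counit (R := k) ((ℛ k a).right i) • (ℛ k a).left i = a := by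
  have := congrArg (TensorProduct.rid k A) (Coalgebra.sum_tmul_counit_eq (ℛ k a))
  simpa only [map_sum, TensorProduct.rid_tmul, one_smul] using this

theorem convPrecomp_right_mul_left (f g : WithConv (A →ₗ[k] k)) (a b : A) :
    (convPrecomp (projRight (k := k)) f * convPrecomp projLeft g).ofConv (a ⊗ₜ b) =
      f.ofConv b * g.ofConv a := by
  rw [conv_mul_apply ((ℛ k a).tmul (ℛ k b))]
  conv_rhs => rw [← Coalgebra.sum_counit_smul (ℛ k a), ← sum_smul_counit (k := k) b]
  simp only [Coalgebra.Repr.tmul, convPrecomp_apply, projLeft_tmul, projRight_tmul,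
    Finset.sum_product, map_sum, map_smul, smul_eq_mul, Finset.sum_mul_sum]
  rw [Finset.sum_comm]
  refine Finset.sum_congr rfl fun _ _ => Finset.sum_congr rfl fun _ _ => ?_
  ring

theorem convPrecomp_left_mul_right (f g : WithConv (A →ₗ[k] k)) (a b : A) :
    (convPrecomp (projLeft (k := k)) g * convPrecomp projRight f).ofConv (a ⊗ₜ b) =
      f.ofConv b * g.ofConv a := by
  rw [conv_mul_apply ((ℛ k a).tmul (ℛ k b))]
  conv_rhs => rw [← sum_smul_counit (k := k) a, ← Coalgebra.sum_counit_smul (ℛ k b)]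
  simp only [Coalgebra.Repr.tmul, convPrecomp_apply, projLeft_tmul, projRight_tmul,
    Finset.sum_product, map_sum, map_smul, smul_eq_mul, Finset.sum_mul_sum]
  rw [Finset.sum_comm]
  refine Finset.sum_congr rfl fun _ _ => Finset.sum_congr rfl fun _ _ => ?_
  ring

/-- Functionals that see different tensor factors commute: either product sends `a ⊗ b` to `f(b)
g(a)`. -/
theorem convPrecomp_commute (f g : WithConv (A →ₗ[k] k)) :
    Commute (convPrecomp (projRight (k := k)) f) (convPrecomp projLeft g) := by
  apply WithConv.ext
  refine TensorProduct.ext' fun a b => ?_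
  exact (convPrecomp_right_mul_left f g a b).trans (convPrecomp_left_mul_right f g a b).symm

end Projections

namespace FRTAlgebra

open WithConv Coalgebra

variable {k : Type*} [Field k] {n : ℕ} {R S : Fin n → Fin n → Fin n → Fin n → k}

/-- The homomorphism `c ↦ ∑ ⟨b | c₁⟩ ⟨a | c₂⟩` to the convolution algebra of `A ⊗ A`. -/
noncomputable def pairingHomSq (h : MixedYangBaxter R S) :
    FRTAlgebra R →ₐ[k] WithConv (FRTAlgebra R ⊗[k] FRTAlgebra R →ₗ[k] k) :=
  (Algebra.TensorProduct.lift ((convPrecomp (projRight (k := k))).comp (pairingHom h))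
    ((convPrecomp (projLeft (k := k))).comp (pairingHom h))
    (fun x y => convPrecomp_commute (pairingHom h x) (pairingHom h y))).comp
      (Bialgebra.comulAlgHom k _)

theorem pairingHomSq_apply (h : MixedYangBaxter R S) {ι : Type*} {c : FRTAlgebra R}
    (r : Coalgebra.Repr k c ι) (a b : FRTAlgebra R) :
    (pairingHomSq h c).ofConv (a ⊗ₜ b) = ∑ i ∈ r.index,
      (pairingHom h (r.left i)).ofConv b * (pairingHom h (r.right i)).ofConv a := by
  have : pairingHomSq h c = ∑ i ∈ r.index,
      convPrecomp (projRight (k := k)) (pairingHom h (r.left i)) *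
        convPrecomp (projLeft (k := k)) (pairingHom h (r.right i)) := by
    rw [pairingHomSq, AlgHom.comp_apply, Bialgebra.comulAlgHom_apply, ← r.eq, map_sum]
    rfl
  rw [this, ofConv_sum, LinearMap.sum_apply]
  exact Finset.sum_congr rfl fun i _ => convPrecomp_right_mul_left _ _ a b

/-- Both sides are algebra maps in `c`, namely `⟨ab | c⟩` and `∑ ⟨b | c₁⟩ ⟨a | c₂⟩`, so generators
suffice. There the equality says that the matrix representation reverses products. -/
theorem convPrecomp_mul_pairingHom (h : MixedYangBaxter R S) :
    (convPrecomp (Bialgebra.mulCoalgHom k (FRTAlgebra R))).comp (pairingHom h) =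
      pairingHomSq h := by
  apply hom_ext
  intro j l
  apply WithConv.ext
  refine TensorProduct.ext' fun a b => ?_
  rw [pairingHomSq_apply h (reprT R j l)]
  change (pairingHom h (T R j l)).ofConv (a * b) = _
  simp only [reprT, pairingHom_T, coef_mul]

theorem pairingHom_apply_mul (h : MixedYangBaxter R S) {ι : Type*} {c : FRTAlgebra R}
    (r : Coalgebra.Repr k c ι) (a b : FRTAlgebra R) :
    (pairingHom h c).ofConv (a * b) = ∑ i ∈ r.index,
      (pairingHom h (r.left i)).ofConv b * (pairingHom h (r.right i)).ofConv a := by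
  rw [← pairingHomSq_apply h r, ← convPrecomp_mul_pairingHom]
  rfl

theorem pairingHom_apply_one (h : MixedYangBaxter R S) (c : FRTAlgebra R) :
    (pairingHom h c).ofConv 1 = counit (R := k) c := by
  induction c using FRTAlgebra.induction with
  | halg c =>
    rw [AlgHom.commutes, Algebra.algebraMap_eq_smul_one, ofConv_smul, LinearMap.smul_apply,
      conv_one_apply]
    simp
  | hT i a => rw [pairingHom_T, counit_T]; exact coef_one h i a
  | hadd x y hx hy => rw [map_add, ofConv_add, LinearMap.add_apply, hx, hy, map_add]
  | hmul x y hx hy =>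
    rw [map_mul, Bialgebra.counit_mul, ← hx, ← hy]
    change LinearMap.mul' k k (TensorProduct.map _ _ (comul 1)) = _
    rw [Bialgebra.comul_one, Algebra.TensorProduct.one_def]
    rfl

theorem isMulPairing_pairing (h : MixedYangBaxter R S) : IsMulPairing (pairing h) where
  one_right := by
    apply WithConv.ext
    ext a
    rw [pairingRight_apply, pairing_tmul, map_one]
  one_left := by
    apply WithConv.ext
    ext c
    rw [pairingLeft_apply, pairing_tmul, pairingHom_apply_one]
    rfl
  mul_right b c := by
    apply WithConv.ext
    ext a
    rw [pairingRight_apply, pairing_tmul, map_mul]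
    rfl
  mul_left a b := by
    apply WithConv.ext
    ext c
    rw [conv_mul_apply (ℛ k c), pairingLeft_apply, pairing_tmul, pairingHom_apply_mul h (ℛ k c)]
    rfl

end FRTAlgebra

/-! ### The braiding axioms as identities in convolution algebras. -/

section Braiding

open WithConv Coalgebra

variable {k A : Type*} [Field k] [Ring A] [Bialgebra k A] {β : A ⊗[k] A →ₗ[k] k}

/-- `b ↦ (a ↦ ∑ ⟨a | b₁⟩ b₂)`. -/
noncomputable def IsMulPairing.pairThenConst (h : IsMulPairing β) :
    A →ₐ[k] WithConv (A →ₗ[k] A) :=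
  (Algebra.TensorProduct.lift ((convOfScalar (k := k) (C := A) (B := A)).comp h.rightHom)
    (convConst (k := k) (C := A) (B := A))
    (fun x y => convOfScalar_commute_convConst (h.rightHom x) y)).comp (Bialgebra.comulAlgHom k A)

/-- `b ↦ (a ↦ ∑ b₁ ⟨a | b₂⟩)`. -/
noncomputable def IsMulPairing.constThenPair (h : IsMulPairing β) :
    A →ₐ[k] WithConv (A →ₗ[k] A) :=
  (Algebra.TensorProduct.lift (convConst (k := k) (C := A) (B := A))
    ((convOfScalar (k := k) (C := A) (B := A)).comp h.rightHom)
    (fun x y => (convOfScalar_commute_convConst (h.rightHom y) x).symm)).comp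
      (Bialgebra.comulAlgHom k A)

theorem IsMulPairing.pairThenConst_mul_id (h : IsMulPairing β) {ι κ : Type*} {a b : A}
    (r : Coalgebra.Repr k a ι) (s : Coalgebra.Repr k b κ) :
    (h.pairThenConst b * toConv LinearMap.id).ofConv a =
      ∑ x ∈ r.index, ∑ y ∈ s.index, β (r.left x ⊗ₜ s.left y) • (s.right y * r.right x) := by
  have : h.pairThenConst b = ∑ y ∈ s.index,
      convOfScalar (k := k) (C := A) (B := A) (pairingRight β (s.left y)) *
        convConst (s.right y) := by
    rw [pairThenConst, AlgHom.comp_apply, Bialgebra.comulAlgHom_apply, ← s.eq, map_sum]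
    rfl
  rw [conv_mul_apply r, this]
  refine Finset.sum_congr rfl fun x _ => ?_
  rw [ofConv_sum, LinearMap.sum_apply, Finset.sum_mul]
  refine Finset.sum_congr rfl fun y _ => ?_
  rw [mul_convConst_apply, convOfScalar_apply, pairingRight_apply, Algebra.smul_def, mul_assoc]
  rfl

theorem IsMulPairing.id_mul_constThenPair (h : IsMulPairing β) {ι κ : Type*} {a b : A}
    (r : Coalgebra.Repr k a ι) (s : Coalgebra.Repr k b κ) :
    (toConv LinearMap.id * h.constThenPair b).ofConv a =
      ∑ x ∈ r.index, ∑ y ∈ s.index, β (r.right x ⊗ₜ s.right y) • (r.left x * s.left y) := by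
  have : h.constThenPair b = ∑ y ∈ s.index,
      convConst (s.left y) *
      convOfScalar (k := k) (C := A) (B := A) (pairingRight β (s.right y)) := by
    rw [constThenPair, AlgHom.comp_apply, Bialgebra.comulAlgHom_apply, ← s.eq, map_sum]
    rfl
  rw [conv_mul_apply r, this]
  refine Finset.sum_congr rfl fun x _ => ?_
  rw [ofConv_sum, LinearMap.sum_apply, Finset.mul_sum]
  refine Finset.sum_congr rfl fun y _ => ?_
  rw [convConst_mul_apply, convOfScalar_apply, pairingRight_apply, Algebra.smul_def,
    ← Algebra.commutes (β _) (s.left y), ← mul_assoc, ← mul_assoc, ← Algebra.commutes]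
  rfl

/-- For a multiplicative map `f` and an antimultiplicative map `g`, the identity
`∑ f(b₁) g(b₂) = ε(b)` is stable under products. -/
theorem sum_hom_mul_anti {B : Type*} [Ring B] [Algebra k B] {f g : A →ₗ[k] B}
    (hf : ∀ x y, f (x * y) = f x * f y) (hg : ∀ x y, g (x * y) = g y * g x) {x y : A}
    (hx : LinearMap.mul' k B (TensorProduct.map f g (comul x)) = algebraMap k B (counit x))
    (hy : LinearMap.mul' k B (TensorProduct.map f g (comul y)) = algebraMap k B (counit y)) :
    LinearMap.mul' k B (TensorProduct.map f g (comul (x * y))) =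
      algebraMap k B (counit (x * y)) := by
  -- In `∑ f(x₁) f(y₁) g(y₂) g(x₂)` the `y`-part is innermost; it collapses to a scalar that can be
  -- pulled out.
  have inner : ∀ (a b : A) (w : A ⊗[k] A),
      LinearMap.mul' k B (TensorProduct.map f g ((a ⊗ₜ b) * w)) =
        f a * LinearMap.mul' k B (TensorProduct.map f g w) * g b := by
    intro a b w
    induction w using TensorProduct.induction_on with
    | zero => simp
    | add c d hc hd => rw [mul_add, map_add, map_add, hc, hd, map_add, map_add, mul_add, add_mul]
    | tmul c d => simp [hf, hg, mul_assoc]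
  have key : ∀ z : A ⊗[k] A, LinearMap.mul' k B (TensorProduct.map f g (z * comul y)) =
      LinearMap.mul' k B (TensorProduct.map f g z) * algebraMap k B (counit y) := by
    intro z
    induction z using TensorProduct.induction_on with
    | zero => simp
    | add a b ha hb => rw [add_mul, map_add, map_add, ha, hb, map_add, map_add, add_mul]
    | tmul a b =>
      rw [inner, hy, mul_assoc, Algebra.commutes, ← mul_assoc]
      rfl
  rw [Bialgebra.comul_mul, key, hx, Bialgebra.counit_mul, map_mul]

/-- For an antimultiplicative map `g` and a multiplicative map `f`, the identity
`∑ g(b₁) f(b₂) = ε(b)` is stable under products. -/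
theorem sum_anti_mul_hom {B : Type*} [Ring B] [Algebra k B] {f g : A →ₗ[k] B}
    (hf : ∀ x y, f (x * y) = f x * f y) (hg : ∀ x y, g (x * y) = g y * g x) {x y : A}
    (hx : LinearMap.mul' k B (TensorProduct.map g f (comul x)) = algebraMap k B (counit x))
    (hy : LinearMap.mul' k B (TensorProduct.map g f (comul y)) = algebraMap k B (counit y)) :
    LinearMap.mul' k B (TensorProduct.map g f (comul (x * y))) =
      algebraMap k B (counit (x * y)) := by
  have inner : ∀ (a b : A) (w : A ⊗[k] A),
      LinearMap.mul' k B (TensorProduct.map g f (w * (a ⊗ₜ b))) =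
        g a * LinearMap.mul' k B (TensorProduct.map g f w) * f b := by
    intro a b w
    induction w using TensorProduct.induction_on with
    | zero => simp
    | add c d hc hd => rw [add_mul, map_add, map_add, hc, hd, map_add, map_add, mul_add, add_mul]
    | tmul c d => simp [hf, hg, mul_assoc]
  have key : ∀ z : A ⊗[k] A, LinearMap.mul' k B (TensorProduct.map g f (comul x * z)) =
      algebraMap k B (counit x) * LinearMap.mul' k B (TensorProduct.map g f z) := by
    intro z
    induction z using TensorProduct.induction_on with
    | zero => simp
    | add a b ha hb => rw [mul_add, map_add, map_add, ha, hb, map_add, map_add, mul_add]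
    | tmul a b =>
      rw [inner, hx, ← Algebra.commutes, mul_assoc]
      rfl
  rw [Bialgebra.comul_mul, key, hy, Bialgebra.counit_mul, map_mul]

theorem IsMulPairing.apply_mul_left (h : IsMulPairing β) {ι : Type*} {c : A}
    (r : Coalgebra.Repr k c ι) (a b : A) :
    β ((a * b) ⊗ₜ c) = ∑ i ∈ r.index, β (b ⊗ₜ r.left i) * β (a ⊗ₜ r.right i) := by
  rw [← pairingLeft_apply, h.mul_left, conv_mul_apply r]
  rfl

theorem IsMulPairing.apply_mul_right (h : IsMulPairing β) {ι : Type*} {a : A}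
    (r : Coalgebra.Repr k a ι) (b c : A) :
    β (a ⊗ₜ (b * c)) = ∑ i ∈ r.index, β (r.left i ⊗ₜ b) * β (r.right i ⊗ₜ c) := by
  rw [← pairingRight_apply, h.mul_right, conv_mul_apply r]
  rfl

theorem IsMulPairing.apply_one_right (h : IsMulPairing β) (a : A) : β (a ⊗ₜ 1) = counit a := by
  rw [← pairingRight_apply, h.one_right]
  rfl

theorem IsMulPairing.apply_one_left (h : IsMulPairing β) (a : A) : β (1 ⊗ₜ a) = counit a := by
  rw [← pairingLeft_apply, h.one_left]
  rfl

/-- `a ↦ a ⊗ 1` as a coalgebra map. -/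
noncomputable def inclLeft : A →ₗc[k] A ⊗[k] A where
  toLinearMap := (TensorProduct.mk k A A).flip 1
  counit_comp := by ext; simp
  map_comp_comul := by
    ext a
    simp [← (ℛ k a).eq, TensorProduct.sum_tmul, Algebra.TensorProduct.one_def]

/-- `a ↦ 1 ⊗ a` as a coalgebra map. -/
noncomputable def inclRight : A →ₗc[k] A ⊗[k] A where
  toLinearMap := TensorProduct.mk k A A 1
  counit_comp := by ext; simp
  map_comp_comul := by
    ext a
    simp [← (ℛ k a).eq, TensorProduct.tmul_sum, Algebra.TensorProduct.one_def]

/-- The unit conditions come from invertibility. The functional `⟨· | 1⟩` is idempotent, and it is a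
unit because it is the restriction of an invertible functional along the coalgebra map `a ↦ a ⊗ 1`;
an idempotent unit is the identity. The other side is the same. -/
theorem IsBraiding.isMulPairing (h : IsBraiding β) : IsMulPairing β := by
  have hr : ∀ b c, pairingRight β (b * c) = pairingRight β b * pairingRight β c := by
    intro b c
    apply WithConv.ext
    ext a
    rw [conv_mul_apply (ℛ k a)]
    exact h.mul_right a b c (ℛ k a)
  have hl : ∀ a b, pairingLeft β (a * b) = pairingLeft β b * pairingLeft β a := by
    intro a b
    apply WithConv.ext
    ext c
    rw [conv_mul_apply (ℛ k c)]
    exact h.mul_left a b c (ℛ k c)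
  refine ⟨?_, ?_, hr, hl⟩
  · have hu : IsUnit (pairingRight β 1) := h.invertible.map
      (convPrecomp (k := k) (B := k) (inclLeft (k := k) (A := A)))
    have := hr 1 1
    rw [mul_one] at this
    exact (hu.mul_eq_left.mp this.symm)
  · have hu : IsUnit (pairingLeft β 1) := h.invertible.map
      (convPrecomp (k := k) (B := k) (inclRight (k := k) (A := A)))
    have := hl 1 1
    rw [mul_one] at this
    exact (hu.mul_eq_left.mp this.symm)

end Braiding

/-! ### Uniqueness and convolution invertibility of pairings on `A(R)`. -/

namespace FRTAlgebra

open WithConv Coalgebra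

variable {k : Type*} [Field k] {n : ℕ} {R : Fin n → Fin n → Fin n → Fin n → k}
  {β β' : FRTAlgebra R ⊗[k] FRTAlgebra R →ₗ[k] k}

/-- A multiplicative pairing on `A(R)` is determined by its values on the generators. -/
theorem pairing_ext (h : IsMulPairing β) (h' : IsMulPairing β')
    (hT : ∀ i a j b, β (T R i a ⊗ₜ T R j b) = β' (T R i a ⊗ₜ T R j b)) : β = β' := by
  have gen : ∀ (a : FRTAlgebra R) (j l : Fin n), β (a ⊗ₜ T R j l) = β' (a ⊗ₜ T R j l) := by
    intro a
    induction a using FRTAlgebra.induction with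
    | halg c =>
      intro j l
      simp only [Algebra.algebraMap_eq_smul_one, ← TensorProduct.smul_tmul', map_smul,
        h.apply_one_left, h'.apply_one_left]
    | hT i a => exact hT i a
    | hadd x y hx hy => intro j l; simp only [TensorProduct.add_tmul, map_add, hx, hy]
    | hmul x y hx hy =>
      intro j l
      rw [h.apply_mul_left (reprT R j l), h'.apply_mul_left (reprT R j l)]
      simp only [reprT, hx, hy]
  have hom : h.rightHom = h'.rightHom := by
    apply hom_ext
    intro j l
    apply WithConv.ext
    ext a
    exact gen a j l
  refine TensorProduct.ext' fun a b => ?_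
  have := congrArg (fun f : WithConv (FRTAlgebra R →ₗ[k] k) => f.ofConv a) (DFunLike.congr_fun hom b)
  exact this

theorem sum_hom_mul_anti_eq_counit {B : Type*} [Ring B] [Algebra k B] {f g : FRTAlgebra R →ₗ[k] B}
    (hf : ∀ x y, f (x * y) = f x * f y) (hg : ∀ x y, g (x * y) = g y * g x)
    (hf1 : f 1 = 1) (hg1 : g 1 = 1)
    (hT : ∀ i a, ∑ m, f (T R i m) * g (T R m a) = if i = a then 1 else 0) (x : FRTAlgebra R) :
    LinearMap.mul' k B (TensorProduct.map f g (comul x)) = algebraMap k B (counit x) := by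
  induction x using FRTAlgebra.induction with
  | halg c =>
    simp [Algebra.algebraMap_eq_smul_one, Algebra.TensorProduct.one_def, hf1, hg1]
  | hT i a => rw [comul_T, counit_T]; simpa [apply_ite] using hT i a
  | hadd x y hx hy => simp only [map_add, hx, hy]
  | hmul x y hx hy => exact sum_hom_mul_anti hf hg hx hy

theorem sum_anti_mul_hom_eq_counit {B : Type*} [Ring B] [Algebra k B] {f g : FRTAlgebra R →ₗ[k] B}
    (hf : ∀ x y, f (x * y) = f x * f y) (hg : ∀ x y, g (x * y) = g y * g x)
    (hf1 : f 1 = 1) (hg1 : g 1 = 1)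
    (hT : ∀ i a, ∑ m, g (T R i m) * f (T R m a) = if i = a then 1 else 0) (x : FRTAlgebra R) :
    LinearMap.mul' k B (TensorProduct.map g f (comul x)) = algebraMap k B (counit x) := by
  induction x using FRTAlgebra.induction with
  | halg c =>
    simp [Algebra.algebraMap_eq_smul_one, Algebra.TensorProduct.one_def, hf1, hg1]
  | hT i a => rw [comul_T, counit_T]; simpa [apply_ite] using hT i a
  | hadd x y hx hy => simp only [map_add, hx, hy]
  | hmul x y hx hy => exact sum_anti_mul_hom hf hg hx hy

/-- The matrix `(⟨a | T_j^l⟩)_{j l}`. -/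
noncomputable def rightMatrix (β : FRTAlgebra R ⊗[k] FRTAlgebra R →ₗ[k] k) :
    FRTAlgebra R →ₗ[k] Matrix (Fin n) (Fin n) k :=
  LinearMap.pi fun j => LinearMap.pi fun l => (pairingRight β (T R j l)).ofConv

/-- The matrix `(⟨T_j^l | a⟩)_{j l}`. -/
noncomputable def leftMatrix (β : FRTAlgebra R ⊗[k] FRTAlgebra R →ₗ[k] k) :
    FRTAlgebra R →ₗ[k] Matrix (Fin n) (Fin n) k :=
  LinearMap.pi fun j => LinearMap.pi fun l => (pairingLeft β (T R j l)).ofConv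

theorem rightMatrix_apply (a : FRTAlgebra R) (j l : Fin n) :
    rightMatrix β a j l = β (a ⊗ₜ T R j l) := rfl

theorem leftMatrix_apply (a : FRTAlgebra R) (j l : Fin n) :
    leftMatrix β a j l = β (T R j l ⊗ₜ a) := rfl

theorem rightMatrix_mul (h : IsMulPairing β) (a b : FRTAlgebra R) :
    rightMatrix β (a * b) = rightMatrix β b * rightMatrix β a := by
  ext j l
  rw [rightMatrix_apply, h.apply_mul_left (reprT R j l), Matrix.mul_apply]
  rfl

theorem leftMatrix_mul (h : IsMulPairing β) (a b : FRTAlgebra R) :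
    leftMatrix β (a * b) = leftMatrix β a * leftMatrix β b := by
  ext j l
  rw [leftMatrix_apply, h.apply_mul_right (reprT R j l), Matrix.mul_apply]
  rfl

theorem rightMatrix_one (h : IsMulPairing β) : rightMatrix β 1 = 1 := by
  ext j l
  rw [rightMatrix_apply, h.apply_one_left, counit_T, Matrix.one_apply]

theorem leftMatrix_one (h : IsMulPairing β) : leftMatrix β 1 = 1 := by
  ext j l
  rw [leftMatrix_apply, h.apply_one_right, counit_T, Matrix.one_apply]

/-- A pairing on `A(R)` is convolution invertible if its matrix of values on the generators is
invertible and the inverse also defines a pairing. -/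
theorem isUnit_pairing (h : IsMulPairing β) (h' : IsMulPairing β')
    (h1 : ∀ i j c l, ∑ r, ∑ m, β (T R i r ⊗ₜ T R j m) * β' (T R m l ⊗ₜ T R r c) =
      if i = c ∧ j = l then 1 else 0)
    (h2 : ∀ i j c l, ∑ r, ∑ m, β' (T R j m ⊗ₜ T R i r) * β (T R r c ⊗ₜ T R m l) =
      if i = c ∧ j = l then 1 else 0) :
    IsUnit (toConv β) := by
  -- The inverse identities are extended from generators one variable at a time: `hM1` and `hM2`
  -- allow arbitrary `a` against a generator, then `hC1` and `hC2` allow arbitrary `b`.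
  have hM1 := sum_anti_mul_hom_eq_counit (f := leftMatrix β') (g := rightMatrix β)
    (leftMatrix_mul h') (rightMatrix_mul h) (leftMatrix_one h') (rightMatrix_one h) (by
      intro i c
      ext j l
      simp only [Matrix.sum_apply, Matrix.mul_apply, rightMatrix_apply, leftMatrix_apply]
      rw [h1]
      split_ifs <;> simp_all [Matrix.one_apply])
  have hM2 := sum_hom_mul_anti_eq_counit (f := leftMatrix β') (g := rightMatrix β)
    (leftMatrix_mul h') (rightMatrix_mul h) (leftMatrix_one h') (rightMatrix_one h) (by
      intro i c
      ext j l
      simp only [Matrix.sum_apply, Matrix.mul_apply, rightMatrix_apply, leftMatrix_apply]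
      rw [h2]
      split_ifs <;> simp_all [Matrix.one_apply])
  have hC1 := sum_hom_mul_anti_eq_counit (f := pairingRight β) (g := pairingLeft β')
    h.mul_right h'.mul_left h.one_right h'.one_left (by
      intro j l
      apply WithConv.ext
      ext a
      have := congrFun (congrFun (hM1 a) j) l
      rw [← (ℛ k a).eq] at this
      simp only [map_sum, TensorProduct.map_tmul, LinearMap.mul'_apply, Matrix.sum_apply,
        Matrix.mul_apply, rightMatrix_apply, leftMatrix_apply] at this
      rw [Finset.sum_comm] at this
      simp only [ofConv_sum, LinearMap.sum_apply, conv_mul_apply (ℛ k a), pairingRight_apply,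
        pairingLeft_apply, this]
      split_ifs with hjl <;> simp [Matrix.algebraMap_matrix_apply, hjl])
  have hC2 := sum_anti_mul_hom_eq_counit (f := pairingRight β) (g := pairingLeft β')
    h.mul_right h'.mul_left h.one_right h'.one_left (by
      intro j l
      apply WithConv.ext
      ext a
      have := congrFun (congrFun (hM2 a) j) l
      rw [← (ℛ k a).eq] at this
      simp only [map_sum, TensorProduct.map_tmul, LinearMap.mul'_apply, Matrix.sum_apply,
        Matrix.mul_apply, rightMatrix_apply, leftMatrix_apply] at this
      rw [Finset.sum_comm] at this
      simp only [ofConv_sum, LinearMap.sum_apply, conv_mul_apply (ℛ k a), pairingRight_apply,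
        pairingLeft_apply, this]
      split_ifs with hjl <;> simp [Matrix.algebraMap_matrix_apply, hjl])
  -- The arguments of `β'` are swapped so that in each variable a multiplicative map meets an
  -- antimultiplicative one.
  have hb1 : toConv β * toConv (β' ∘ₗ (TensorProduct.comm k _ _).toLinearMap) = 1 := by
    apply WithConv.ext
    refine TensorProduct.ext' fun a b => ?_
    have := congrArg (fun f : WithConv (FRTAlgebra R →ₗ[k] k) => f.ofConv a) (hC1 b)
    simp only [← (ℛ k b).eq, map_sum, TensorProduct.map_tmul, LinearMap.mul'_apply, ofConv_sum,
      LinearMap.sum_apply, conv_mul_apply (ℛ k a), pairingRight_apply, pairingLeft_apply] at this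
    rw [conv_mul_apply ((ℛ k a).tmul (ℛ k b))]
    simp only [Coalgebra.Repr.tmul, Finset.sum_product]
    rw [Finset.sum_comm]
    refine this.trans ?_
    simp [Algebra.algebraMap_eq_smul_one, mul_comm]
  have hb2 : toConv (β' ∘ₗ (TensorProduct.comm k _ _).toLinearMap) * toConv β = 1 := by
    apply WithConv.ext
    refine TensorProduct.ext' fun a b => ?_
    have := congrArg (fun f : WithConv (FRTAlgebra R →ₗ[k] k) => f.ofConv a) (hC2 b)
    simp only [← (ℛ k b).eq, map_sum, TensorProduct.map_tmul, LinearMap.mul'_apply, ofConv_sum,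
      LinearMap.sum_apply, conv_mul_apply (ℛ k a), pairingRight_apply, pairingLeft_apply] at this
    rw [conv_mul_apply ((ℛ k a).tmul (ℛ k b))]
    simp only [Coalgebra.Repr.tmul, Finset.sum_product]
    rw [Finset.sum_comm]
    refine this.trans ?_
    simp [Algebra.algebraMap_eq_smul_one, mul_comm]
  exact ⟨⟨_, _, hb1, hb2⟩, rfl⟩

end FRTAlgebra

/-! ### The commutation axiom, and the braiding of `A(R)`. -/

namespace FRTAlgebra

open WithConv Coalgebra

variable {k : Type*} [Field k] {n : ℕ} {R : Fin n → Fin n → Fin n → Fin n → k}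
  {β : FRTAlgebra R ⊗[k] FRTAlgebra R →ₗ[k] k}

/-- `x ⊗ y ↦ ⟨x | T_j^m⟩ y`. -/
noncomputable def evalLeft (β : FRTAlgebra R ⊗[k] FRTAlgebra R →ₗ[k] k) (j m : Fin n) :
    FRTAlgebra R ⊗[k] FRTAlgebra R →ₗ[k] FRTAlgebra R :=
  (TensorProduct.lid k _).toLinearMap ∘ₗ (pairingRight β (T R j m)).ofConv.rTensor _

/-- `x ⊗ y ↦ ⟨y | T_j^m⟩ x`. -/
noncomputable def evalRight (β : FRTAlgebra R ⊗[k] FRTAlgebra R →ₗ[k] k) (j m : Fin n) :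
    FRTAlgebra R ⊗[k] FRTAlgebra R →ₗ[k] FRTAlgebra R :=
  (TensorProduct.rid k _).toLinearMap ∘ₗ (pairingRight β (T R j m)).ofConv.lTensor _

theorem evalLeft_tmul (j m : Fin n) (x y : FRTAlgebra R) :
    evalLeft β j m (x ⊗ₜ y) = β (x ⊗ₜ T R j m) • y := rfl

theorem evalRight_tmul (j m : Fin n) (x y : FRTAlgebra R) :
    evalRight β j m (x ⊗ₜ y) = β (y ⊗ₜ T R j m) • x := rfl

theorem evalLeft_mul (h : IsMulPairing β) (j l : Fin n) (z w : FRTAlgebra R ⊗[k] FRTAlgebra R) :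
    evalLeft β j l (z * w) = ∑ m, evalLeft β m l z * evalLeft β j m w := by
  induction z using TensorProduct.induction_on with
  | zero => simp
  | add a b ha hb => simp only [add_mul, map_add, ha, hb, Finset.sum_add_distrib]
  | tmul x y =>
    induction w using TensorProduct.induction_on with
    | zero => simp
    | add a b ha hb => simp only [mul_add, map_add, ha, hb, Finset.sum_add_distrib]
    | tmul x' y' =>
      rw [Algebra.TensorProduct.tmul_mul_tmul, evalLeft_tmul, h.apply_mul_left (reprT R j l)]
      simp only [evalLeft_tmul, smul_mul_smul_comm, Finset.sum_smul, reprT]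
      exact Finset.sum_congr rfl fun _ _ => by rw [mul_comm]

theorem evalRight_mul (h : IsMulPairing β) (j l : Fin n) (z w : FRTAlgebra R ⊗[k] FRTAlgebra R) :
    evalRight β j l (z * w) = ∑ m, evalRight β m l z * evalRight β j m w := by
  induction z using TensorProduct.induction_on with
  | zero => simp
  | add a b ha hb => simp only [add_mul, map_add, ha, hb, Finset.sum_add_distrib]
  | tmul x y =>
    induction w using TensorProduct.induction_on with
    | zero => simp
    | add a b ha hb => simp only [mul_add, map_add, ha, hb, Finset.sum_add_distrib]
    | tmul x' y' =>
      rw [Algebra.TensorProduct.tmul_mul_tmul, evalRight_tmul, h.apply_mul_left (reprT R j l)]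
      simp only [evalRight_tmul, smul_mul_smul_comm, Finset.sum_smul, reprT]
      exact Finset.sum_congr rfl fun _ _ => by rw [mul_comm]

/-- The commutation axiom with a generator in the second slot. For two generators it is the RTT
relation; for a product `x y` the generator is moved first past `x`, then past `y`. -/
theorem comm_generator (h : IsMulPairing β)
    (hT : ∀ i a j b, β (T R i a ⊗ₜ T R j b) = R j i b a) (x : FRTAlgebra R) :
    ∀ j l : Fin n, ∑ m, T R m l * evalLeft β j m (comul x) =
      ∑ m, evalRight β m l (comul x) * T R j m := by
  induction x using FRTAlgebra.induction with
  | halg c =>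
    intro j l
    simp [Algebra.algebraMap_eq_smul_one, Algebra.TensorProduct.one_def, evalLeft_tmul,
      evalRight_tmul, h.apply_one_left, counit_T]
  | hT i a =>
    intro j l
    have := rtt R i j l a
    simp only [comul_T, map_sum, evalLeft_tmul, evalRight_tmul, hT, Finset.mul_sum,
      Finset.sum_mul, smul_mul_assoc, mul_smul_comm]
    exact this.trans Finset.sum_comm
  | hadd x y hx hy =>
    intro j l
    simp only [map_add, mul_add, add_mul, Finset.sum_add_distrib, hx, hy]
  | hmul x y hx hy =>
    intro j l
    simp only [Bialgebra.comul_mul, evalLeft_mul h, evalRight_mul h, Finset.mul_sum,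
      Finset.sum_mul]
    calc _ = ∑ r, (∑ m, T R m l * evalLeft β r m (comul x)) * evalLeft β j r (comul y) := by
          rw [Finset.sum_comm]
          simp only [Finset.sum_mul, mul_assoc]
      _ = ∑ m, evalRight β m l (comul x) * ∑ r, T R r m * evalLeft β j r (comul y) := by
          simp only [hx, Finset.sum_mul, Finset.mul_sum, mul_assoc]
          exact Finset.sum_comm
      _ = _ := by
          simp only [hy, Finset.mul_sum, mul_assoc]
          exact Finset.sum_comm

theorem pairThenConst_T (h : IsMulPairing β) (x : FRTAlgebra R) (j l : Fin n) :
    (h.pairThenConst (T R j l) * toConv LinearMap.id).ofConv x =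
      ∑ m, T R m l * evalLeft β j m (comul x) := by
  rw [h.pairThenConst_mul_id (ℛ k x) (reprT R j l), ← (ℛ k x).eq]
  simp only [map_sum, evalLeft_tmul, Finset.mul_sum, mul_smul_comm]
  exact Finset.sum_comm

theorem constThenPair_T (h : IsMulPairing β) (x : FRTAlgebra R) (j l : Fin n) :
    (toConv LinearMap.id * h.constThenPair (T R j l)).ofConv x =
      ∑ m, evalRight β m l (comul x) * T R j m := by
  rw [h.id_mul_constThenPair (ℛ k x) (reprT R j l), ← (ℛ k x).eq]
  simp only [map_sum, evalRight_tmul, Finset.sum_mul, smul_mul_assoc]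
  exact Finset.sum_comm

/-- The commutation axiom has the form `F(b) * id = id * G(b)` with `F` and `G` homomorphisms, and
such an identity is inherited by products: `F(b) F(c) id = F(b) id G(c) = id G(b) G(c)`. -/
theorem pairThenConst_mul_id_eq (h : IsMulPairing β)
    (hT : ∀ i a j b, β (T R i a ⊗ₜ T R j b) = R j i b a) (b : FRTAlgebra R) :
    h.pairThenConst b * toConv LinearMap.id = toConv LinearMap.id * h.constThenPair b := by
  induction b using FRTAlgebra.induction with
  | halg c => rw [AlgHom.commutes, AlgHom.commutes, Algebra.commutes]
  | hT j l =>
    apply WithConv.ext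
    ext x
    rw [pairThenConst_T, constThenPair_T, comm_generator h hT]
  | hadd x y hx hy => rw [map_add, map_add, add_mul, mul_add, hx, hy]
  | hmul x y hx hy =>
    rw [map_mul, map_mul, mul_assoc, hy, ← mul_assoc, hx, mul_assoc]

theorem isBraiding_of_isMulPairing (h : IsMulPairing β) (hu : IsUnit (toConv β))
    (hT : ∀ i a j b, β (T R i a ⊗ₜ T R j b) = R j i b a) : IsBraiding β where
  comm a b _ _ r s := by
    rw [← h.pairThenConst_mul_id r s, pairThenConst_mul_id_eq h hT, h.id_mul_constThenPair r s]
  invertible := hu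
  mul_right a b c _ r := h.apply_mul_right r b c
  mul_left a b c _ s := h.apply_mul_left s a b

/-- If `R` and `S` satisfy the Yang–Baxter type equations and `S` is the inverse of `R_{21}`, then
`A(R)` has exactly one braiding with `⟨T_i^a | T_j^b⟩ = R_{ji}^{ba}`. -/
theorem existsUnique_braiding {S : Fin n → Fin n → Fin n → Fin n → k}
    (hR : MixedYangBaxter R R) (hS : MixedYangBaxter R S)
    (h1 : ∀ i j c l, ∑ r, ∑ m, R j i m r * S r m c l = if i = c ∧ j = l then 1 else 0)
    (h2 : ∀ i j c l, ∑ r, ∑ m, S i j r m * R m r l c = if i = c ∧ j = l then 1 else 0) :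
    ∃! β : FRTAlgebra R ⊗[k] FRTAlgebra R →ₗ[k] k, IsBraiding β ∧
      ∀ i a j b, β (T R i a ⊗ₜ T R j b) = R j i b a := by
  refine ⟨pairing hR, ⟨?_, pairing_T_T hR⟩, fun β' hβ' => ?_⟩
  · refine isBraiding_of_isMulPairing (isMulPairing_pairing hR) ?_ (pairing_T_T hR)
    refine isUnit_pairing (isMulPairing_pairing hR) (isMulPairing_pairing hS) ?_ ?_
    · intro i j c l
      simp only [pairing_T_T]
      exact h1 i j c l
    · intro i j c l
      simp only [pairing_T_T]
      exact h2 i j c l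
  · refine pairing_ext hβ'.1.isMulPairing (isMulPairing_pairing hR) fun i a j b => ?_
    rw [hβ'.2, pairing_T_T]

end FRTAlgebra

/-! ### The Yang–Baxter equation for the Cremmer–Gervais matrix -/

section Monomials

variable {n : ℕ}

/-- A polynomial with infinitely many roots is zero. The exceptional set `s` makes room for formulas
with denominators such as `x - y`. -/
theorem coeff_eq_of_eval_eq (s : Finset ℂ) (c d : Fin n → ℂ)
    (h : ∀ x ∉ s, ∑ t, c t * x ^ (t : ℕ) = ∑ t, d t * x ^ (t : ℕ)) (t : Fin n) : c t = d t := by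
  classical
  let P : Polynomial ℂ := ∑ t : Fin n, Polynomial.C (c t - d t) * Polynomial.X ^ (t : ℕ)
  have hP : P = 0 := by
    refine Polynomial.eq_zero_of_infinite_isRoot P ?_
    refine (Set.Finite.infinite_compl s.finite_toSet).mono fun x hx => ?_
    have := h x (by simpa using hx)
    simp only [P, Set.mem_ofPred_eq, Polynomial.IsRoot, Polynomial.eval_finsetSum,
      Polynomial.eval_mul, Polynomial.eval_C, Polynomial.eval_pow, Polynomial.eval_X, sub_mul,
      Finset.sum_sub_distrib, this, sub_self]
  have h0 := congrArg (fun Q => Polynomial.coeff Q (t : ℕ)) hP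
  simp only [P, Polynomial.finsetSum_coeff, Polynomial.coeff_C_mul, Polynomial.coeff_X_pow,
    Polynomial.coeff_zero, mul_ite, mul_one, mul_zero, Fin.val_inj, Finset.sum_ite_eq,
    Finset.mem_univ, if_true] at h0
  exact sub_eq_zero.mp h0

theorem coeff_two_eq_of_eval_eq (c d : Fin n → Fin n → ℂ)
    (h : ∀ x y : ℂ, x ≠ y → ∑ t, ∑ a, c t a * x ^ (t : ℕ) * y ^ (a : ℕ) =
      ∑ t, ∑ a, d t a * x ^ (t : ℕ) * y ^ (a : ℕ)) (t a : Fin n) : c t a = d t a := by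
  refine coeff_eq_of_eval_eq ∅ (c t) (d t) (fun y _ => ?_) a
  refine coeff_eq_of_eval_eq {y} (fun t => ∑ a, c t a * y ^ (a : ℕ))
    (fun t => ∑ a, d t a * y ^ (a : ℕ)) (fun x hx => ?_) t
  simpa only [Finset.sum_mul, mul_right_comm] using h x y (by simpa using hx)

theorem coeff_three_eq_of_eval_eq (c d : Fin n → Fin n → Fin n → ℂ)
    (h : ∀ x y z : ℂ, x ≠ y → x ≠ z → y ≠ z →
      ∑ t, ∑ a, ∑ b, c t a b * x ^ (t : ℕ) * y ^ (a : ℕ) * z ^ (b : ℕ) =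
      ∑ t, ∑ a, ∑ b, d t a b * x ^ (t : ℕ) * y ^ (a : ℕ) * z ^ (b : ℕ)) (t a b : Fin n) :
    c t a b = d t a b := by
  refine coeff_two_eq_of_eval_eq (c t) (d t) (fun y z hyz => ?_) a b
  refine coeff_eq_of_eval_eq {y, z} (fun t => ∑ a, ∑ b, c t a b * y ^ (a : ℕ) * z ^ (b : ℕ))
    (fun t => ∑ a, ∑ b, d t a b * y ^ (a : ℕ) * z ^ (b : ℕ)) (fun x hx => ?_) t
  simp only [Finset.mem_insert, Finset.mem_singleton, not_or] at hx
  have := h x y z hx.1 hx.2 hyz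
  have e : ∀ e : Fin n → Fin n → Fin n → ℂ,
      ∑ t, (∑ a, ∑ b, e t a b * y ^ (a : ℕ) * z ^ (b : ℕ)) * x ^ (t : ℕ) =
        ∑ t, ∑ a, ∑ b, e t a b * x ^ (t : ℕ) * y ^ (a : ℕ) * z ^ (b : ℕ) := by
    intro e
    simp only [Finset.sum_mul]
    exact Finset.sum_congr rfl fun _ _ => Finset.sum_congr rfl fun _ _ =>
      Finset.sum_congr rfl fun _ _ => by ring
  rw [e, e, this]

/-- The condition `s = k + l` eliminates `l`. The bounds on `s` ensure that `s - k` is not truncated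
and is a legal index below `n`. -/
theorem sum_sum_band {M : Type*} [AddCommMonoid M] (f : ℕ → ℕ → M) {a b s : ℕ} (hb : b ≤ n)
    (hbs : b ≤ s + 1) (hs : s < n + a) :
    ∑ k : Fin n, ∑ l : Fin n,
      (if a ≤ (k : ℕ) ∧ (k : ℕ) < b ∧ s = k + l then f k l else 0) =
      ∑ k ∈ Finset.Ico a b, f k (s - k) := by
  have inner : ∀ k : Fin n, ∑ l : Fin n,
      (if a ≤ (k : ℕ) ∧ (k : ℕ) < b ∧ s = k + l then f k l else 0) =
      if a ≤ (k : ℕ) ∧ (k : ℕ) < b then f k (s - k) else 0 := by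
    intro k
    by_cases hk : a ≤ (k : ℕ) ∧ (k : ℕ) < b
    · rw [if_pos hk, Finset.sum_eq_single (⟨s - k, by omega⟩ : Fin n)]
      · rw [if_pos ⟨hk.1, hk.2, by simp only; omega⟩]
      · intro l _ hl
        rw [if_neg]
        rintro ⟨_, _, h⟩
        exact hl (Fin.ext (by simp only; omega))
      · simp
    · rw [if_neg hk]
      exact Finset.sum_eq_zero fun l _ => if_neg fun h => hk ⟨h.1, h.2.1⟩
  simp only [inner]
  rw [Fin.sum_univ_eq_sum_range (fun k => if a ≤ k ∧ k < b then f k (s - k) else 0),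
    ← Finset.sum_filter]
  refine Finset.sum_congr ?_ fun _ _ => rfl
  ext k
  simp only [Finset.mem_filter, Finset.mem_range, Finset.mem_Ico]
  omega

end Monomials

section CremmerGervais

variable {n : ℕ} {q p : ℂ}

theorem cremmerGervais_eq (i j k l : Fin n) :
    cremmerGervais n q p i j k l =
      p⁻¹ * p ^ (2 * ((l : ℤ) - (i : ℤ))) * cremmerGervais n q 1 i j k l := by
  unfold cremmerGervais
  split_ifs <;> simp <;> ring

theorem cremmerGervais_support {i j k l : Fin n} (h : cremmerGervais n q p i j k l ≠ 0) :
    (i : ℕ) + j = k + l := by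
  unfold cremmerGervais at h
  split_ifs at h with h1 h2 h3 h4
  · rw [h1.1, h1.2.1]
  · rw [h2.1, h2.2.1]
  · exact h3.2.2
  · exact h4.2.2
  · simp at h

/-- Apart from its diagonal entry, a row of `R` has constant coefficients along a band with `k + l`
fixed. The corresponding monomials form a geometric sum, giving the divided difference `(x^d - y^d)
/ (x - y)`. -/
theorem sum_cremmerGervais_mul (i j : Fin n) (x y : ℂ) (hxy : x ≠ y) :
    ∑ k, ∑ l, cremmerGervais n q 1 i j k l * x ^ (k : ℕ) * y ^ (l : ℕ) =
      (q + (q - q⁻¹) * (y / (x - y))) * (x ^ (i : ℕ) * y ^ (j : ℕ)) +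
        -((q - q⁻¹) * (y / (x - y))) * (x ^ (j : ℕ) * y ^ (i : ℕ)) := by
  have hxy' : x - y ≠ 0 := sub_ne_zero.mpr hxy
  have diag : ∀ c : ℂ, ∑ k : Fin n, ∑ l : Fin n,
      (if i = k ∧ j = l then c * x ^ (k : ℕ) * y ^ (l : ℕ) else 0) =
      c * x ^ (i : ℕ) * y ^ (j : ℕ) := by
    intro c
    simp [ite_and, Finset.sum_ite_eq]
  rcases lt_trichotomy (i : ℕ) j with hij | hij | hij
  · have h : ∀ k l : Fin n, cremmerGervais n q 1 i j k l * x ^ (k : ℕ) * y ^ (l : ℕ) =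
        (if i = k ∧ j = l then q⁻¹ * x ^ (k : ℕ) * y ^ (l : ℕ) else 0) +
        (q⁻¹ - q) * (if (i : ℕ) + 1 ≤ (k : ℕ) ∧ (k : ℕ) < j ∧ (i : ℕ) + j = k + l then
          x ^ (k : ℕ) * y ^ (l : ℕ) else 0) := by
      intro k l
      unfold cremmerGervais
      simp only [Fin.lt_def, Fin.le_def, Fin.ext_iff, inv_one, one_zpow, mul_one, one_mul]
      split_ifs <;> first | omega | ring
    simp only [h, Finset.sum_add_distrib, ← Finset.mul_sum, diag]
    rw [sum_sum_band (fun k l => x ^ k * y ^ l) (by omega) (by omega) (by omega)]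
    obtain ⟨d, hd⟩ : ∃ d, (j : ℕ) = i + 1 + d := ⟨j - i - 1, by omega⟩
    have hsum : ∑ k ∈ Finset.Ico ((i : ℕ) + 1) j, x ^ k * y ^ ((i : ℕ) + j - k) =
        x ^ ((i : ℕ) + 1) * y ^ ((i : ℕ) + 1) * ((x ^ d - y ^ d) / (x - y)) := by
      rw [Finset.sum_Ico_eq_sum_range, ← geom_sum₂_mul, mul_div_cancel_right₀ _ hxy',
        Finset.mul_sum, show (j : ℕ) - (i + 1) = d by omega]
      refine Finset.sum_congr rfl fun r hr => ?_
      rw [Finset.mem_range] at hr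
      rw [show (i : ℕ) + j - (i + 1 + r) = (i + 1) + (d - 1 - r) by omega, pow_add, pow_add]
      ring
    rw [hsum, hd]
    field_simp
    ring
  · have h : ∀ k l : Fin n, cremmerGervais n q 1 i j k l * x ^ (k : ℕ) * y ^ (l : ℕ) =
        (if i = k ∧ j = l then q * x ^ (k : ℕ) * y ^ (l : ℕ) else 0) := by
      intro k l
      unfold cremmerGervais
      simp only [Fin.lt_def, Fin.le_def, Fin.ext_iff, inv_one, one_zpow, mul_one, one_mul]
      split_ifs <;> first | omega | ring
    simp only [h, diag, hij]
    ring
  · have h : ∀ k l : Fin n, cremmerGervais n q 1 i j k l * x ^ (k : ℕ) * y ^ (l : ℕ) =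
        (if i = k ∧ j = l then q * x ^ (k : ℕ) * y ^ (l : ℕ) else 0) +
        (q - q⁻¹) * (if (j : ℕ) ≤ (k : ℕ) ∧ (k : ℕ) < i ∧ (i : ℕ) + j = k + l then
          x ^ (k : ℕ) * y ^ (l : ℕ) else 0) := by
      intro k l
      unfold cremmerGervais
      simp only [Fin.lt_def, Fin.le_def, Fin.ext_iff, inv_one, one_zpow, mul_one, one_mul]
      split_ifs <;> first | omega | ring
    simp only [h, Finset.sum_add_distrib, ← Finset.mul_sum, diag]
    rw [sum_sum_band (fun k l => x ^ k * y ^ l) (by omega) (by omega) (by omega)]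
    obtain ⟨d, hd⟩ : ∃ d, (i : ℕ) = j + d := ⟨i - j, by omega⟩
    have hsum : ∑ k ∈ Finset.Ico (j : ℕ) i, x ^ k * y ^ ((i : ℕ) + j - k) =
        x ^ (j : ℕ) * y ^ ((j : ℕ) + 1) * ((x ^ d - y ^ d) / (x - y)) := by
      rw [Finset.sum_Ico_eq_sum_range, ← geom_sum₂_mul, mul_div_cancel_right₀ _ hxy',
        Finset.mul_sum, show (i : ℕ) - j = d by omega]
      refine Finset.sum_congr rfl fun r hr => ?_
      rw [Finset.mem_range] at hr
      rw [show (i : ℕ) + j - (j + r) = (j + 1) + (d - 1 - r) by omega, pow_add, pow_add]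
      ring
    rw [hsum, hd]
    field_simp
    ring

end CremmerGervais

/-! ### Yang–Baxter equations from the action on functions of three variables. -/

section YangBaxter

variable {n : ℕ}

/-- The matrix `R` acts on monomials `x^i y^j` as `f ↦ α f + β f(y, x)`. -/
def ActsOnMonomials (R : Fin n → Fin n → Fin n → Fin n → ℂ) (α β : ℂ → ℂ → ℂ) : Prop :=
  ∀ (i j : Fin n) (x y : ℂ), x ≠ y → ∑ k, ∑ l, R i j k l * (x ^ (k : ℕ) * y ^ (l : ℕ)) =
    α x y * (x ^ (i : ℕ) * y ^ (j : ℕ)) + β x y * (x ^ (j : ℕ) * y ^ (i : ℕ))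

theorem sum_comm_three_three {M : Type*} [AddCommMonoid M]
    (f : Fin n → Fin n → Fin n → Fin n → Fin n → Fin n → M) :
    ∑ t, ∑ a, ∑ b, ∑ u, ∑ v, ∑ m, f t a b u v m = ∑ u, ∑ v, ∑ m, ∑ t, ∑ a, ∑ b, f t a b u v m := by
  have h : ∀ g : Fin n → Fin n → Fin n → M,
      ∑ t, ∑ a, ∑ b, g t a b = ∑ w : Fin n × Fin n × Fin n, g w.1 w.2.1 w.2.2 := by
    intro g
    simp only [Fintype.sum_prod_type]
  simp only [h]
  exact Finset.sum_comm

variable {R S : Fin n → Fin n → Fin n → Fin n → ℂ} {α β γ δ : ℂ → ℂ → ℂ}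

/-- The value of `R` on a function of the two variables. -/
theorem ActsOnMonomials.sum_mul (h : ActsOnMonomials R α β) (i j : Fin n) {x y x' y' : ℂ}
    (hxy : x ≠ y) (hxy' : x' ≠ y') (c c' : ℂ) :
    ∑ k, ∑ l, R i j k l * (c * (x ^ (k : ℕ) * y ^ (l : ℕ)) + c' * (x' ^ (k : ℕ) * y' ^ (l : ℕ))) =
      c * (α x y * (x ^ (i : ℕ) * y ^ (j : ℕ)) + β x y * (x ^ (j : ℕ) * y ^ (i : ℕ))) +
      c' * (α x' y' * (x' ^ (i : ℕ) * y' ^ (j : ℕ)) + β x' y' * (x' ^ (j : ℕ) * y' ^ (i : ℕ))) := by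
  rw [← h i j x y hxy, ← h i j x' y' hxy']
  simp only [Finset.mul_sum, ← Finset.sum_add_distrib]
  exact Finset.sum_congr rfl fun _ _ => Finset.sum_congr rfl fun _ _ => by ring

theorem ActsOnMonomials.sum_mul_four (h : ActsOnMonomials R α β) (i j : Fin n)
    {x₁ y₁ x₂ y₂ x₃ y₃ x₄ y₄ : ℂ} (h₁ : x₁ ≠ y₁) (h₂ : x₂ ≠ y₂) (h₃ : x₃ ≠ y₃) (h₄ : x₄ ≠ y₄)
    (c₁ c₂ c₃ c₄ : ℂ) :
    ∑ k, ∑ l, R i j k l *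
        (c₁ * (x₁ ^ (k : ℕ) * y₁ ^ (l : ℕ)) + c₂ * (x₂ ^ (k : ℕ) * y₂ ^ (l : ℕ)) +
          (c₃ * (x₃ ^ (k : ℕ) * y₃ ^ (l : ℕ)) + c₄ * (x₄ ^ (k : ℕ) * y₄ ^ (l : ℕ)))) =
      c₁ * (α x₁ y₁ * (x₁ ^ (i : ℕ) * y₁ ^ (j : ℕ)) + β x₁ y₁ * (x₁ ^ (j : ℕ) * y₁ ^ (i : ℕ))) +
      c₂ * (α x₂ y₂ * (x₂ ^ (i : ℕ) * y₂ ^ (j : ℕ)) + β x₂ y₂ * (x₂ ^ (j : ℕ) * y₂ ^ (i : ℕ))) +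
      (c₃ * (α x₃ y₃ * (x₃ ^ (i : ℕ) * y₃ ^ (j : ℕ)) + β x₃ y₃ * (x₃ ^ (j : ℕ) * y₃ ^ (i : ℕ))) +
      c₄ * (α x₄ y₄ * (x₄ ^ (i : ℕ) * y₄ ^ (j : ℕ)) + β x₄ y₄ * (x₄ ^ (j : ℕ) * y₄ ^ (i : ℕ)))) := by
  rw [← h.sum_mul i j h₁ h₂, ← h.sum_mul i j h₃ h₄]
  simp only [← Finset.sum_add_distrib, mul_add]

/-- Three operators are applied in turn, the first two producing four terms and the last acting on
each of them. Here, and in `sum_right_lhs`, `R` acts last; on the two right-hand sides it acts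
first. -/
theorem sum_left_lhs (hR : ActsOnMonomials R α β) (hS : ActsOnMonomials S γ δ) (s j i : Fin n)
    {x y z : ℂ} (hxy : x ≠ y) (hxz : x ≠ z) (hyz : y ≠ z) :
    ∑ t, ∑ a, ∑ b, (∑ u, ∑ v, ∑ m, R j i u v * S s v m b * S m u t a) *
        x ^ (t : ℕ) * y ^ (a : ℕ) * z ^ (b : ℕ) =
      γ x y * γ x z * x ^ (s : ℕ) *
        (α y z * (y ^ (j : ℕ) * z ^ (i : ℕ)) + β y z * (y ^ (i : ℕ) * z ^ (j : ℕ))) +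
      γ x y * δ x z * z ^ (s : ℕ) *
        (α y x * (y ^ (j : ℕ) * x ^ (i : ℕ)) + β y x * (y ^ (i : ℕ) * x ^ (j : ℕ))) +
      (δ x y * γ y z * y ^ (s : ℕ) *
        (α x z * (x ^ (j : ℕ) * z ^ (i : ℕ)) + β x z * (x ^ (i : ℕ) * z ^ (j : ℕ))) +
      δ x y * δ y z * z ^ (s : ℕ) *
        (α x y * (x ^ (j : ℕ) * y ^ (i : ℕ)) + β x y * (x ^ (i : ℕ) * y ^ (j : ℕ)))) := by
  rw [← hR.sum_mul_four j i hyz hxy.symm hxz hxy]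
  simp only [Finset.sum_mul]
  rw [sum_comm_three_three]
  refine Finset.sum_congr rfl fun u _ => Finset.sum_congr rfl fun v _ => ?_
  trans R j i u v * ∑ m, ∑ b, S s v m b *
    ((γ x y * y ^ (u : ℕ)) * (x ^ (m : ℕ) * z ^ (b : ℕ)) +
      (δ x y * x ^ (u : ℕ)) * (y ^ (m : ℕ) * z ^ (b : ℕ)))
  · rw [Finset.mul_sum]
    refine Finset.sum_congr rfl fun m _ => ?_
    trans ∑ b, R j i u v * S s v m b * z ^ (b : ℕ) *
      ∑ t, ∑ a, S m u t a * (x ^ (t : ℕ) * y ^ (a : ℕ))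
    · simp only [Finset.mul_sum]
      rw [Finset.sum_comm_cycle]
      refine Finset.sum_congr rfl fun _ _ => Finset.sum_congr rfl fun _ _ =>
        Finset.sum_congr rfl fun _ _ => ?_
      ring
    · rw [hS m u x y hxy, Finset.mul_sum]
      refine Finset.sum_congr rfl fun _ _ => ?_
      ring
  · rw [hS.sum_mul s v hxz hyz]
    ring

theorem sum_left_rhs (hR : ActsOnMonomials R α β) (hS : ActsOnMonomials S γ δ) (s j i : Fin n)
    {x y z : ℂ} (hxy : x ≠ y) (hxz : x ≠ z) (hyz : y ≠ z) :
    ∑ t, ∑ a, ∑ b, (∑ u, ∑ v, ∑ m, R v u a b * S s j m v * S m i t u) *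
        x ^ (t : ℕ) * y ^ (a : ℕ) * z ^ (b : ℕ) =
      α y z * γ x z * z ^ (i : ℕ) *
        (γ x y * (x ^ (s : ℕ) * y ^ (j : ℕ)) + δ x y * (x ^ (j : ℕ) * y ^ (s : ℕ))) +
      α y z * δ x z * x ^ (i : ℕ) *
        (γ z y * (z ^ (s : ℕ) * y ^ (j : ℕ)) + δ z y * (z ^ (j : ℕ) * y ^ (s : ℕ))) +
      (β y z * γ x y * y ^ (i : ℕ) *
        (γ x z * (x ^ (s : ℕ) * z ^ (j : ℕ)) + δ x z * (x ^ (j : ℕ) * z ^ (s : ℕ))) +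
      β y z * δ x y * x ^ (i : ℕ) *
        (γ y z * (y ^ (s : ℕ) * z ^ (j : ℕ)) + δ y z * (y ^ (j : ℕ) * z ^ (s : ℕ)))) := by
  rw [← hS.sum_mul_four s j hxy hyz.symm hxz hyz]
  simp only [Finset.sum_mul]
  rw [sum_comm_three_three, Finset.sum_comm_cycle]
  refine Finset.sum_congr rfl fun m _ => ?_
  rw [Finset.sum_comm]
  refine Finset.sum_congr rfl fun v _ => ?_
  trans S s j m v * ∑ t, ∑ u, S m i t u *
    ((α y z * y ^ (v : ℕ)) * (x ^ (t : ℕ) * z ^ (u : ℕ)) +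
      (β y z * z ^ (v : ℕ)) * (x ^ (t : ℕ) * y ^ (u : ℕ)))
  · rw [Finset.mul_sum, Finset.sum_comm]
    refine Finset.sum_congr rfl fun t _ => ?_
    rw [Finset.mul_sum]
    refine Finset.sum_congr rfl fun u _ => ?_
    trans S s j m v * S m i t u * x ^ (t : ℕ) * ∑ a, ∑ b, R v u a b * (y ^ (a : ℕ) * z ^ (b : ℕ))
    · simp only [Finset.mul_sum]
      refine Finset.sum_congr rfl fun _ _ => Finset.sum_congr rfl fun _ _ => ?_
      ring
    · rw [hR v u y z hyz]
      ring
  · rw [hS.sum_mul m i hxz hxy]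
    ring

theorem sum_right_lhs (hR : ActsOnMonomials R α β) (hS : ActsOnMonomials S γ δ) (i j c : Fin n)
    {x y z : ℂ} (hxy : x ≠ y) (hxz : x ≠ z) (hyz : y ≠ z) :
    ∑ a, ∑ b, ∑ d, (∑ u, ∑ v, ∑ m, R j i u v * S u c a m * S v m b d) *
        x ^ (a : ℕ) * y ^ (b : ℕ) * z ^ (d : ℕ) =
      γ y z * γ x z * z ^ (c : ℕ) *
        (α x y * (x ^ (j : ℕ) * y ^ (i : ℕ)) + β x y * (x ^ (i : ℕ) * y ^ (j : ℕ))) +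
      γ y z * δ x z * x ^ (c : ℕ) *
        (α z y * (z ^ (j : ℕ) * y ^ (i : ℕ)) + β z y * (z ^ (i : ℕ) * y ^ (j : ℕ))) +
      (δ y z * γ x y * y ^ (c : ℕ) *
        (α x z * (x ^ (j : ℕ) * z ^ (i : ℕ)) + β x z * (x ^ (i : ℕ) * z ^ (j : ℕ))) +
      δ y z * δ x y * x ^ (c : ℕ) *
        (α y z * (y ^ (j : ℕ) * z ^ (i : ℕ)) + β y z * (y ^ (i : ℕ) * z ^ (j : ℕ)))) := by
  rw [← hR.sum_mul_four j i hxy hyz.symm hxz hyz]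
  simp only [Finset.sum_mul]
  rw [sum_comm_three_three]
  refine Finset.sum_congr rfl fun u _ => Finset.sum_congr rfl fun v _ => ?_
  trans R j i u v * ∑ a, ∑ m, S u c a m *
    ((γ y z * y ^ (v : ℕ)) * (x ^ (a : ℕ) * z ^ (m : ℕ)) +
      (δ y z * z ^ (v : ℕ)) * (x ^ (a : ℕ) * y ^ (m : ℕ)))
  · rw [Finset.mul_sum, Finset.sum_comm]
    refine Finset.sum_congr rfl fun a _ => ?_
    rw [Finset.mul_sum]
    refine Finset.sum_congr rfl fun m _ => ?_
    trans R j i u v * S u c a m * x ^ (a : ℕ) * ∑ b, ∑ d, S v m b d * (y ^ (b : ℕ) * z ^ (d : ℕ))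
    · simp only [Finset.mul_sum]
      refine Finset.sum_congr rfl fun _ _ => Finset.sum_congr rfl fun _ _ => ?_
      ring
    · rw [hS v m y z hyz]
      ring
  · rw [hS.sum_mul u c hxz hxy]
    ring

theorem sum_right_rhs (hR : ActsOnMonomials R α β) (hS : ActsOnMonomials S γ δ) (i j c : Fin n)
    {x y z : ℂ} (hxy : x ≠ y) (hxz : x ≠ z) (hyz : y ≠ z) :
    ∑ a, ∑ b, ∑ d, (∑ u, ∑ v, ∑ m, R v u a b * S i c u m * S j m v d) *
        x ^ (a : ℕ) * y ^ (b : ℕ) * z ^ (d : ℕ) =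
      α x y * γ x z * x ^ (j : ℕ) *
        (γ y z * (y ^ (i : ℕ) * z ^ (c : ℕ)) + δ y z * (y ^ (c : ℕ) * z ^ (i : ℕ))) +
      α x y * δ x z * z ^ (j : ℕ) *
        (γ y x * (y ^ (i : ℕ) * x ^ (c : ℕ)) + δ y x * (y ^ (c : ℕ) * x ^ (i : ℕ))) +
      (β x y * γ y z * y ^ (j : ℕ) *
        (γ x z * (x ^ (i : ℕ) * z ^ (c : ℕ)) + δ x z * (x ^ (c : ℕ) * z ^ (i : ℕ))) +
      β x y * δ y z * z ^ (j : ℕ) *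
        (γ x y * (x ^ (i : ℕ) * y ^ (c : ℕ)) + δ x y * (x ^ (c : ℕ) * y ^ (i : ℕ)))) := by
  rw [← hS.sum_mul_four i c hyz hxy.symm hxz hxy]
  simp only [Finset.sum_mul]
  rw [sum_comm_three_three]
  refine Finset.sum_congr rfl fun u _ => ?_
  rw [Finset.sum_comm]
  refine Finset.sum_congr rfl fun m _ => ?_
  trans S i c u m * ∑ v, ∑ d, S j m v d *
    ((α x y * y ^ (u : ℕ)) * (x ^ (v : ℕ) * z ^ (d : ℕ)) +
      (β x y * x ^ (u : ℕ)) * (y ^ (v : ℕ) * z ^ (d : ℕ)))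
  · rw [Finset.mul_sum]
    refine Finset.sum_congr rfl fun v _ => ?_
    rw [Finset.mul_sum, Finset.sum_comm_cycle]
    refine Finset.sum_congr rfl fun d _ => ?_
    trans S i c u m * S j m v d * z ^ (d : ℕ) * ∑ a, ∑ b, R v u a b * (x ^ (a : ℕ) * y ^ (b : ℕ))
    · simp only [Finset.mul_sum]
      refine Finset.sum_congr rfl fun _ _ => Finset.sum_congr rfl fun _ _ => ?_
      ring
    · rw [hR v u x y hxy]
      ring
  · rw [hS.sum_mul j m hxz hyz]
    ring

/-- The case `κ = 0` is `S = R`. For `κ = 1` the numerator `y + κ (x - y)` is `x`, which is the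
action of `R` minus `c` times the flip, the candidate for `R_21⁻¹`. -/
theorem mixedYangBaxter_of_actsOnMonomials {q c κ : ℂ} (hκ : κ = 0 ∨ κ = 1)
    (hR : ActsOnMonomials R (fun x y => q + c * (y / (x - y))) (fun x y => -(c * (y / (x - y)))))
    (hS : ActsOnMonomials S (fun x y => q + c * (y / (x - y)))
      (fun x y => -(c * ((y + κ * (x - y)) / (x - y))))) :
    FRTAlgebra.MixedYangBaxter R S := by
  refine ⟨fun s j i t a b => ?_, fun i j a b e d => ?_⟩
  · refine coeff_three_eq_of_eval_eq
      (fun t a b => ∑ u, ∑ v, ∑ m, R j i u v * S s v m b * S m u t a)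
      (fun t a b => ∑ u, ∑ v, ∑ m, R v u a b * S s j m v * S m i t u)
      (fun x y z hxy hxz hyz => ?_) t a b
    rw [sum_left_lhs hR hS s j i hxy hxz hyz, sum_left_rhs hR hS s j i hxy hxz hyz]
    have h1 := sub_ne_zero.mpr hxy
    have h2 := sub_ne_zero.mpr hxz
    have h3 := sub_ne_zero.mpr hyz
    -- Only `x - y`, `x - z` and `y - z` are left as denominators. With the powers turned into
    -- symbols, a rational identity independent of the exponents remains.
    rw [← neg_sub x y, ← neg_sub y z]
    generalize x ^ (s : ℕ) = xs, x ^ (j : ℕ) = xj, x ^ (i : ℕ) = xi, y ^ (s : ℕ) = ys,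
      y ^ (j : ℕ) = yj, y ^ (i : ℕ) = yi, z ^ (s : ℕ) = zs, z ^ (j : ℕ) = zj, z ^ (i : ℕ) = zi
    rcases hκ with rfl | rfl <;> field_simp <;> ring
  · refine coeff_three_eq_of_eval_eq
      (fun a b d => ∑ u, ∑ v, ∑ m, R j i u v * S u e a m * S v m b d)
      (fun a b d => ∑ u, ∑ v, ∑ m, R v u a b * S i e u m * S j m v d)
      (fun x y z hxy hxz hyz => ?_) a b d
    rw [sum_right_lhs hR hS i j e hxy hxz hyz, sum_right_rhs hR hS i j e hxy hxz hyz]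
    have h1 := sub_ne_zero.mpr hxy
    have h2 := sub_ne_zero.mpr hxz
    have h3 := sub_ne_zero.mpr hyz
    rw [← neg_sub x y, ← neg_sub y z]
    generalize x ^ (e : ℕ) = xs, x ^ (j : ℕ) = xj, x ^ (i : ℕ) = xi, y ^ (e : ℕ) = ys,
      y ^ (j : ℕ) = yj, y ^ (i : ℕ) = yi, z ^ (e : ℕ) = zs, z ^ (j : ℕ) = zj, z ^ (i : ℕ) = zi
    rcases hκ with rfl | rfl <;> field_simp <;> ring

/-- The exponents add up to a common value only by virtue of `i + j = k + l`, which is known only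
for nonzero entries; hence the conditional `he`. -/
theorem mul_three_twist {p c d : ℂ} {A B C A' B' C' : ℂ} {e₁ e₂ e₃ e : ℤ} (hp : p ≠ 0)
    (hA : A' = c * p ^ (2 * e₁) * A) (hB : B' = d * p ^ (2 * e₂) * B)
    (hC : C' = d * p ^ (2 * e₃) * C)
    (he : A ≠ 0 → B ≠ 0 → C ≠ 0 → e₁ + e₂ + e₃ = e) :
    A' * B' * C' = c * d * d * p ^ (2 * e) * (A * B * C) := by
  by_cases hA0 : A = 0
  · simp [hA, hA0]
  by_cases hB0 : B = 0
  · simp [hB, hB0]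
  by_cases hC0 : C = 0
  · simp [hC, hC0]
  rw [← he hA0 hB0 hC0, hA, hB, hC, mul_add, mul_add, zpow_add₀ hp, zpow_add₀ hp]
  ring

/-- The Yang–Baxter type equations are stable under rescaling the entries `R_{ij}^{kl}` by
`c p^{2(l - i)}`. -/
theorem mixedYangBaxter_twist {R' S' : Fin n → Fin n → Fin n → Fin n → ℂ} {p c d : ℂ} (hp : p ≠ 0)
    (hR0 : ∀ i j k l, R i j k l ≠ 0 → (i : ℕ) + j = k + l)
    (hS0 : ∀ i j k l, S i j k l ≠ 0 → (i : ℕ) + j = k + l)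
    (hR : ∀ i j k l, R' i j k l = c * p ^ (2 * ((l : ℤ) - (i : ℤ))) * R i j k l)
    (hS : ∀ i j k l, S' i j k l = d * p ^ (2 * ((l : ℤ) - (i : ℤ))) * S i j k l)
    (h : FRTAlgebra.MixedYangBaxter R S) : FRTAlgebra.MixedYangBaxter R' S' := by
  refine ⟨fun s j i t a b => ?_, fun i j a b e w => ?_⟩
  -- The exponent does not involve `u`, `v`, `m` and is the same in `hr`, so it leaves both sums.
  · have hl : ∀ u v m : Fin n, R' j i u v * S' s v m b * S' m u t a =
        c * d * d * p ^ (2 * (2 * (b : ℤ) + a - 2 * s - j)) *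
          (R j i u v * S s v m b * S m u t a) := fun u v m =>
      mul_three_twist hp (hR j i u v) (hS s v m b) (hS m u t a) fun h1 h2 h3 => by
        have := hR0 _ _ _ _ h1
        have := hS0 _ _ _ _ h2
        have := hS0 _ _ _ _ h3
        omega
    have hr : ∀ u v m : Fin n, R' v u a b * S' s j m v * S' m i t u =
        c * d * d * p ^ (2 * (2 * (b : ℤ) + a - 2 * s - j)) *
          (R v u a b * S s j m v * S m i t u) := fun u v m =>
      mul_three_twist hp (hR v u a b) (hS s j m v) (hS m i t u) fun h1 h2 h3 => by
        have := hR0 _ _ _ _ h1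
        have := hS0 _ _ _ _ h2
        have := hS0 _ _ _ _ h3
        omega
    simp only [hl, hr, ← Finset.mul_sum, h.left]
  · have hl : ∀ u v m : Fin n, R' j i u v * S' u e a m * S' v m b w =
        c * d * d * p ^ (2 * ((w : ℤ) - j + e - a)) *
          (R j i u v * S u e a m * S v m b w) := fun u v m =>
      mul_three_twist hp (hR j i u v) (hS u e a m) (hS v m b w) fun h1 h2 h3 => by
        have := hR0 _ _ _ _ h1
        have := hS0 _ _ _ _ h2
        have := hS0 _ _ _ _ h3
        omega
    have hr : ∀ u v m : Fin n, R' v u a b * S' i e u m * S' j m v w =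
        c * d * d * p ^ (2 * ((w : ℤ) - j + e - a)) *
          (R v u a b * S i e u m * S j m v w) := fun u v m =>
      mul_three_twist hp (hR v u a b) (hS i e u m) (hS j m v w) fun h1 h2 h3 => by
        have := hR0 _ _ _ _ h1
        have := hS0 _ _ _ _ h2
        have := hS0 _ _ _ _ h3
        omega
    simp only [hl, hr, ← Finset.mul_sum, h.right]

end YangBaxter

/-! ### The inverse of `R_21` and the Cremmer–Gervais braiding. -/

section CremmerGervais

variable {n : ℕ} {q p : ℂ}

/-- The inverse of `R_{21}` for `R = R_n(q, p)`. -/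
noncomputable def cremmerGervaisInv (n : ℕ) (q p : ℂ) (i j k l : Fin n) : ℂ :=
  p * p ^ (2 * ((l : ℤ) - (i : ℤ))) *
    (cremmerGervais n q 1 i j k l - if k = j ∧ l = i then q - q⁻¹ else 0)

theorem actsOnMonomials_cremmerGervais : ActsOnMonomials (cremmerGervais n q 1)
    (fun x y => q + (q - q⁻¹) * (y / (x - y))) (fun x y => -((q - q⁻¹) * (y / (x - y)))) := by
  intro i j x y hxy
  simp only [← mul_assoc]
  rw [sum_cremmerGervais_mul i j x y hxy]
  ring

theorem cremmerGervaisInv_one (i j k l : Fin n) : cremmerGervaisInv n q 1 i j k l =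
    cremmerGervais n q 1 i j k l - if k = j ∧ l = i then q - q⁻¹ else 0 := by
  simp [cremmerGervaisInv]

theorem actsOnMonomials_cremmerGervaisInv : ActsOnMonomials (cremmerGervaisInv n q 1)
    (fun x y => q + (q - q⁻¹) * (y / (x - y)))
    (fun x y => -((q - q⁻¹) * ((y + 1 * (x - y)) / (x - y)))) := by
  intro i j x y hxy
  have hxy' : x - y ≠ 0 := sub_ne_zero.mpr hxy
  have hd : ∑ k : Fin n, ∑ l : Fin n, (if k = j ∧ l = i then q - q⁻¹ else 0) *
      (x ^ (k : ℕ) * y ^ (l : ℕ)) = (q - q⁻¹) * (x ^ (j : ℕ) * y ^ (i : ℕ)) := by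
    simp [ite_and]
  simp only [cremmerGervaisInv_one, sub_mul (cremmerGervais n q 1 _ _ _ _),
    Finset.sum_sub_distrib, hd]
  rw [actsOnMonomials_cremmerGervais i j x y hxy]
  field_simp
  ring

theorem cremmerGervaisInv_one_support {i j k l : Fin n} (h : cremmerGervaisInv n q 1 i j k l ≠ 0) :
    (i : ℕ) + j = k + l := by
  by_contra hne
  rw [cremmerGervaisInv_one, if_neg, not_ne_iff.mp (fun h => hne (cremmerGervais_support h))] at h
  · simp at h
  · rintro ⟨rfl, rfl⟩
    exact hne (add_comm _ _)

theorem mixedYangBaxter_cremmerGervais (hp : p ≠ 0) :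
    FRTAlgebra.MixedYangBaxter (cremmerGervais n q p) (cremmerGervais n q p) := by
  refine mixedYangBaxter_twist hp (fun _ _ _ _ => cremmerGervais_support)
    (fun _ _ _ _ => cremmerGervais_support) (cremmerGervais_eq) (cremmerGervais_eq)
    (mixedYangBaxter_of_actsOnMonomials (κ := 0) (Or.inl rfl) actsOnMonomials_cremmerGervais ?_)
  simpa using actsOnMonomials_cremmerGervais

theorem mixedYangBaxter_cremmerGervaisInv (hp : p ≠ 0) :
    FRTAlgebra.MixedYangBaxter (cremmerGervais n q p) (cremmerGervaisInv n q p) := by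
  refine mixedYangBaxter_twist (d := p) hp (fun _ _ _ _ => cremmerGervais_support)
    (fun _ _ _ _ => cremmerGervaisInv_one_support) (cremmerGervais_eq) (fun i j k l => ?_)
    (mixedYangBaxter_of_actsOnMonomials (κ := 1) (Or.inr rfl) actsOnMonomials_cremmerGervais
      actsOnMonomials_cremmerGervaisInv)
  rw [cremmerGervaisInv_one, cremmerGervaisInv]

theorem sum_delta_mul (i j : Fin n) (x y : ℂ) :
    ∑ c : Fin n, ∑ l : Fin n, (if i = c ∧ j = l then 1 else 0) * x ^ (c : ℕ) * y ^ (l : ℕ) =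
      x ^ (i : ℕ) * y ^ (j : ℕ) := by
  simp [ite_and]

/-- With `P` the flip, this is the Hecke relation `(PR)⁻¹ = PR - (q - q⁻¹)`, which makes `R - (q -
q⁻¹) P` inverse to `R_21`. -/
theorem sum_cremmerGervais_mul_inv_one (hq : q ≠ 0) (i j c l : Fin n) :
    ∑ r, ∑ m, cremmerGervais n q 1 j i m r * cremmerGervaisInv n q 1 r m c l =
      if i = c ∧ j = l then 1 else 0 := by
  refine coeff_two_eq_of_eval_eq
    (fun c l => ∑ r, ∑ m, cremmerGervais n q 1 j i m r * cremmerGervaisInv n q 1 r m c l)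
    (fun c l => if i = c ∧ j = l then 1 else 0) (fun x y hxy => ?_) c l
  have hxy' : x - y ≠ 0 := sub_ne_zero.mpr hxy
  trans ∑ m, ∑ r, cremmerGervais n q 1 j i m r *
    ((q + (q - q⁻¹) * (y / (x - y))) * (y ^ (m : ℕ) * x ^ (r : ℕ)) +
      (-((q - q⁻¹) * ((y + 1 * (x - y)) / (x - y)))) * (x ^ (m : ℕ) * y ^ (r : ℕ)))
  · simp only [Finset.sum_mul]
    rw [FRTAlgebra.sum_comm_four, Finset.sum_comm]
    refine Finset.sum_congr rfl fun m _ => Finset.sum_congr rfl fun r _ => ?_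
    have := actsOnMonomials_cremmerGervaisInv (q := q) r m x y hxy
    rw [mul_comm (y ^ (m : ℕ)), ← this, Finset.mul_sum]
    refine Finset.sum_congr rfl fun _ _ => ?_
    rw [Finset.mul_sum]
    exact Finset.sum_congr rfl fun _ _ => by ring
  · rw [actsOnMonomials_cremmerGervais.sum_mul j i hxy.symm hxy, ← neg_sub x y, sum_delta_mul]
    field_simp
    ring

theorem sum_inv_mul_cremmerGervais_one (hq : q ≠ 0) (i j c l : Fin n) :
    ∑ r, ∑ m, cremmerGervaisInv n q 1 i j r m * cremmerGervais n q 1 m r l c =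
      if i = c ∧ j = l then 1 else 0 := by
  refine coeff_two_eq_of_eval_eq
    (fun c l => ∑ r, ∑ m, cremmerGervaisInv n q 1 i j r m * cremmerGervais n q 1 m r l c)
    (fun c l => if i = c ∧ j = l then 1 else 0) (fun x y hxy => ?_) c l
  have hxy' : x - y ≠ 0 := sub_ne_zero.mpr hxy
  trans ∑ r, ∑ m, cremmerGervaisInv n q 1 i j r m *
    ((q + (q - q⁻¹) * (x / (y - x))) * (x ^ (r : ℕ) * y ^ (m : ℕ)) +
      (-((q - q⁻¹) * (x / (y - x)))) * (y ^ (r : ℕ) * x ^ (m : ℕ)))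
  · simp only [Finset.sum_mul]
    rw [FRTAlgebra.sum_comm_four]
    refine Finset.sum_congr rfl fun r _ => Finset.sum_congr rfl fun m _ => ?_
    have := actsOnMonomials_cremmerGervais (q := q) m r y x hxy.symm
    rw [mul_comm (x ^ (r : ℕ)), ← this, Finset.mul_sum, Finset.sum_comm]
    refine Finset.sum_congr rfl fun _ _ => ?_
    rw [Finset.mul_sum]
    exact Finset.sum_congr rfl fun _ _ => by ring
  · rw [actsOnMonomials_cremmerGervaisInv.sum_mul i j hxy hxy.symm, ← neg_sub x y, sum_delta_mul]
    field_simp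
    ring

theorem sum_cremmerGervais_mul_inv (hq : q ≠ 0) (hp : p ≠ 0) (i j c l : Fin n) :
    ∑ r, ∑ m, cremmerGervais n q p j i m r * cremmerGervaisInv n q p r m c l =
      if i = c ∧ j = l then 1 else 0 := by
  have h : ∀ r m : Fin n, cremmerGervais n q p j i m r * cremmerGervaisInv n q p r m c l =
      p ^ (2 * ((l : ℤ) - (j : ℤ))) *
        (cremmerGervais n q 1 j i m r * cremmerGervaisInv n q 1 r m c l) := by
    intro r m
    rw [cremmerGervais_eq, cremmerGervaisInv_one, cremmerGervaisInv,
      show 2 * ((l : ℤ) - j) = 2 * ((r : ℤ) - j) + 2 * ((l : ℤ) - r) by ring, zpow_add₀ hp]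
    field_simp
  simp only [h, ← Finset.mul_sum]
  rw [sum_cremmerGervais_mul_inv_one hq]
  split_ifs with hc
  · simp [hc.2]
  · simp

theorem sum_inv_mul_cremmerGervais (hq : q ≠ 0) (hp : p ≠ 0) (i j c l : Fin n) :
    ∑ r, ∑ m, cremmerGervaisInv n q p i j r m * cremmerGervais n q p m r l c =
      if i = c ∧ j = l then 1 else 0 := by
  have h : ∀ r m : Fin n, cremmerGervaisInv n q p i j r m * cremmerGervais n q p m r l c =
      p ^ (2 * ((c : ℤ) - (i : ℤ))) *
        (cremmerGervaisInv n q 1 i j r m * cremmerGervais n q 1 m r l c) := by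
    intro r m
    rw [cremmerGervais_eq, cremmerGervaisInv_one, cremmerGervaisInv,
      show 2 * ((c : ℤ) - i) = 2 * ((m : ℤ) - i) + 2 * ((c : ℤ) - m) by ring, zpow_add₀ hp]
    field_simp
  simp only [h, ← Finset.mul_sum]
  rw [sum_inv_mul_cremmerGervais_one hq]
  split_ifs with hc
  · simp [hc.1]
  · simp

theorem existsUnique_cgBraiding (hq : q ≠ 0) (hp : p ≠ 0) :
    ∃! β : CGAlgebra n q p ⊗[ℂ] CGAlgebra n q p →ₗ[ℂ] ℂ, IsCGBraiding n q p β :=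
  FRTAlgebra.existsUnique_braiding (mixedYangBaxter_cremmerGervais hp)
    (mixedYangBaxter_cremmerGervaisInv hp) (sum_cremmerGervais_mul_inv hq hp)
    (sum_inv_mul_cremmerGervais hq hp)

end CremmerGervais

/-! ### The exterior algebra as a skew polynomial algebra -/

section ExteriorRelations

variable {n : ℕ} {q p : ℂ} {M : Type*} [AddCommGroup M] [Module ℂ M]

/-- Exchanging `k` and `l` preserves the band and negates each term, so the sum equals its own
negative. -/
theorem sum_band_eq_zero (f : Fin n → Fin n → M) (a b : ℕ) (c : ℤ)
    (h : ∀ k l : Fin n, a < k → (k : ℕ) < b → a + b = k + l →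
      p ^ (2 * ((l : ℤ) - c)) • f k l + p ^ (2 * ((k : ℤ) - c)) • f l k = 0) :
    ∑ k : Fin n, ∑ l : Fin n, (if a < (k : ℕ) ∧ (k : ℕ) < b ∧ a + b = k + l then
      p ^ (2 * ((l : ℤ) - c)) • f k l else 0) = 0 := by
  set g : Fin n → Fin n → M := fun k l => if a < (k : ℕ) ∧ (k : ℕ) < b ∧ a + b = k + l then
      p ^ (2 * ((l : ℤ) - c)) • f k l else 0 with hg
  have hanti : ∀ k l, g k l = -g l k := by
    intro k l
    rw [eq_neg_iff_add_eq_zero]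
    by_cases hkl : a < (k : ℕ) ∧ (k : ℕ) < b ∧ a + b = k + l
    · simp only [hg]
      rw [if_pos hkl, if_pos ⟨by omega, by omega, by omega⟩]
      exact h k l hkl.1 hkl.2.1 hkl.2.2
    · simp only [hg]
      rw [if_neg hkl, if_neg (fun h' => hkl ⟨by omega, by omega, by omega⟩), add_zero]
  have hself : ∑ k, ∑ l, g k l = -∑ k, ∑ l, g k l := by
    conv_lhs => rw [Finset.sum_comm]
    simp only [← Finset.sum_neg_distrib]
    exact Finset.sum_congr rfl fun k _ => Finset.sum_congr rfl fun l _ => hanti l k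
  have h2 : (2 : ℂ) • ∑ k, ∑ l, g k l = 0 := by
    rw [two_smul]
    exact eq_neg_iff_add_eq_zero.mp hself
  exact (smul_eq_zero.mp h2).resolve_left two_ne_zero

theorem sum_ite_pair {M : Type*} [AddCommMonoid M] (i j : Fin n) (m : M) :
    ∑ k : Fin n, ∑ l : Fin n, (if i = k ∧ j = l then m else 0) = m := by
  simp [ite_and]

theorem sum_cremmerGervais_smul_of_lt (hp : p ≠ 0) (f : Fin n → Fin n → M) {i j : Fin n}
    (hij : i < j) :
    ∑ k, ∑ l, (p * cremmerGervais n q p i j k l) • f k l =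
      (q⁻¹ * p ^ (2 * ((j : ℤ) - (i : ℤ)))) • f i j +
      (q⁻¹ - q) • ∑ k : Fin n, ∑ l : Fin n,
        (if (i : ℕ) < (k : ℕ) ∧ (k : ℕ) < j ∧ (i : ℕ) + j = k + l then
          p ^ (2 * ((l : ℤ) - (i : ℤ))) • f k l else 0) := by
  rw [← sum_ite_pair i j ((q⁻¹ * p ^ (2 * ((j : ℤ) - (i : ℤ)))) • f i j), Finset.smul_sum,
    ← Finset.sum_add_distrib]
  refine Finset.sum_congr rfl fun k _ => ?_
  rw [Finset.smul_sum, ← Finset.sum_add_distrib]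
  refine Finset.sum_congr rfl fun l _ => ?_
  rw [cremmerGervais, mul_inv_cancel_left₀ hp]
  by_cases hkl : i = k ∧ j = l
  · obtain ⟨rfl, rfl⟩ := hkl
    simp [hij, hij.not_ge]
  · rw [if_neg (fun h => hkl ⟨h.1, h.2.1⟩), if_neg (fun h => hkl ⟨h.1, h.2.1⟩), if_neg, if_neg hkl]
    · simp only [Fin.lt_def, zero_add]
      split_ifs
      · rw [smul_smul]
      · simp
    · simp only [Fin.le_def, Fin.lt_def] at hij ⊢
      omega

theorem sum_cremmerGervais_smul_self (hp : p ≠ 0) (f : Fin n → Fin n → M) (i : Fin n) :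
    ∑ k, ∑ l, (p * cremmerGervais n q p i i k l) • f k l = q • f i i := by
  rw [← sum_ite_pair i i (q • f i i)]
  refine Finset.sum_congr rfl fun k _ => Finset.sum_congr rfl fun l _ => ?_
  rw [cremmerGervais, mul_inv_cancel_left₀ hp]
  by_cases hkl : i = k ∧ i = l
  · obtain ⟨rfl, rfl⟩ := hkl
    simp
  · rw [if_neg (fun h => hkl ⟨h.1, h.2.1⟩), if_neg (fun h => hkl ⟨h.1, h.2.1⟩), if_neg, if_neg,
      if_neg hkl, zero_smul] <;> simp only [Fin.le_def, Fin.lt_def] <;> omega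

/-- For `i > j` the band includes its end `k = j`, `l = i`, where the power of `p` is trivial.
Splitting this term off leaves a band symmetric in `k` and `l`. -/
theorem sum_cremmerGervais_smul_of_gt (hp : p ≠ 0) (f : Fin n → Fin n → M) {i j : Fin n}
    (hij : j < i) :
    ∑ k, ∑ l, (p * cremmerGervais n q p i j k l) • f k l =
      (q * p ^ (2 * ((j : ℤ) - (i : ℤ)))) • f i j + (q - q⁻¹) • f j i +
      (q - q⁻¹) • ∑ k : Fin n, ∑ l : Fin n,
        (if (j : ℕ) < (k : ℕ) ∧ (k : ℕ) < i ∧ (j : ℕ) + i = k + l then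
          p ^ (2 * ((l : ℤ) - (i : ℤ))) • f k l else 0) := by
  rw [← sum_ite_pair i j ((q * p ^ (2 * ((j : ℤ) - (i : ℤ)))) • f i j),
    ← sum_ite_pair j i ((q - q⁻¹) • f j i), Finset.smul_sum,
    ← Finset.sum_add_distrib, ← Finset.sum_add_distrib]
  refine Finset.sum_congr rfl fun k _ => ?_
  rw [Finset.smul_sum, ← Finset.sum_add_distrib, ← Finset.sum_add_distrib]
  refine Finset.sum_congr rfl fun l _ => ?_
  rw [cremmerGervais, mul_inv_cancel_left₀ hp]
  by_cases hkl : i = k ∧ j = l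
  · obtain ⟨rfl, rfl⟩ := hkl
    simp [hij.le, hij.ne]
  by_cases hkl' : j = k ∧ i = l
  · obtain ⟨rfl, rfl⟩ := hkl'
    simp [hij, hij.ne', add_comm]
  · rw [if_neg (fun h => hkl ⟨h.1, h.2.1⟩), if_neg (fun h => hkl ⟨h.1, h.2.1⟩), if_neg hkl,
      if_neg hkl']
    by_cases h : (j : ℕ) < (k : ℕ) ∧ (k : ℕ) < i ∧ (j : ℕ) + i = k + l
    · rw [if_pos h, if_pos, smul_smul, zero_add, zero_add]
      simp only [Fin.le_def, Fin.lt_def]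
      omega
    · rw [if_neg h, if_neg, if_neg]
      · simp
      · simp only [Fin.lt_def] at hij ⊢
        omega
      · simp only [Fin.le_def, Fin.lt_def, Fin.ext_iff] at hij hkl hkl' ⊢
        omega

end ExteriorRelations

/-! ### Skew commutation in `Λ(R)` and nonvanishing of the top form. -/

namespace CGExterior

variable {n : ℕ} {q p : ℂ}

theorem x_mul_self (hq : q ≠ 0) (hp : p ≠ 0) (hq2 : q ^ 2 ≠ -1) (i : Fin n) :
    x n q p i * x n q p i = 0 := by
  have h := x_rel n q p i i
  rw [sum_cremmerGervais_smul_self hp (fun k l => x n q p k * x n q p l), ← add_smul] at h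
  refine (smul_eq_zero.mp h).resolve_left fun h0 => hq2 ?_
  field_simp at h0
  linear_combination h0

/-- The extra terms of the relation involve only pairs strictly between `i` and `j`. By induction on
`j - i` these already skew commute, so they cancel in pairs. -/
theorem x_mul_x_of_lt (hq : q ≠ 0) (hp : p ≠ 0) (hq2 : q ^ 2 ≠ -1) {i j : Fin n} (hij : i < j) :
    x n q p j * x n q p i = -(p ^ (2 * ((j : ℤ) - (i : ℤ))) • (x n q p i * x n q p j)) := by
  induction hd : (j : ℕ) - i using Nat.strong_induction_on generalizing i j with
  | _ d ih =>
    have h := x_rel n q p i j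
    have hz := sum_band_eq_zero (p := p) (fun k l => x n q p k * x n q p l) i j i (by
      intro k l h1 h2 h3
      rcases lt_trichotomy k l with hkl | rfl | hkl
      · rw [ih (l - k) (by omega) hkl rfl, smul_neg, smul_smul, ← zpow_add₀ hp,
          show 2 * ((k : ℤ) - i) + 2 * ((l : ℤ) - k) = 2 * ((l : ℤ) - i) by ring, add_neg_cancel]
      · simp [x_mul_self hq hp hq2]
      · rw [ih (k - l) (by omega) hkl rfl, smul_neg, smul_smul, ← zpow_add₀ hp,
          show 2 * ((l : ℤ) - i) + 2 * ((k : ℤ) - l) = 2 * ((k : ℤ) - i) by ring, neg_add_cancel])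
    rw [sum_cremmerGervais_smul_of_lt hp (fun k l => x n q p k * x n q p l) hij, hz, smul_zero,
      add_zero, mul_smul, ← smul_add] at h
    exact eq_neg_of_add_eq_zero_left ((smul_eq_zero.mp h).resolve_left (inv_ne_zero hq))

/-- Elements that square to zero and skew commute satisfy the relations of `Λ(R)`. -/
theorem rel_of_skewComm {B : Type*} [Ring B] [Algebra ℂ B] (hp : p ≠ 0)
    (y : Fin n → B)
    (h0 : ∀ i, y i * y i = 0)
    (h1 : ∀ i j, i < j → y j * y i = -(p ^ (2 * ((j : ℤ) - (i : ℤ))) • (y i * y j)))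
    (i j : Fin n) :
    q⁻¹ • (y j * y i) + ∑ k, ∑ l, (p * cremmerGervais n q p i j k l) • (y k * y l) = 0 := by
  have hanti : ∀ (c : ℤ) (k l : Fin n), p ^ (2 * ((l : ℤ) - c)) • (y k * y l) +
      p ^ (2 * ((k : ℤ) - c)) • (y l * y k) = 0 := by
    intro c k l
    rcases lt_trichotomy k l with hkl | rfl | hkl
    · rw [h1 k l hkl, smul_neg, smul_smul, ← zpow_add₀ hp,
        show 2 * ((k : ℤ) - c) + 2 * ((l : ℤ) - k) = 2 * ((l : ℤ) - c) by ring, add_neg_cancel]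
    · simp [h0]
    · rw [h1 l k hkl, smul_neg, smul_smul, ← zpow_add₀ hp,
        show 2 * ((l : ℤ) - c) + 2 * ((k : ℤ) - l) = 2 * ((k : ℤ) - c) by ring, neg_add_cancel]
  rcases lt_trichotomy i j with hij | rfl | hij
  · rw [sum_cremmerGervais_smul_of_lt hp (fun k l => y k * y l) hij,
      sum_band_eq_zero (fun k l => y k * y l) i j i fun k l _ _ _ => hanti i k l,
      h1 i j hij, smul_zero, add_zero, mul_smul, smul_neg, neg_add_cancel]
  · rw [sum_cremmerGervais_smul_self hp (fun k l => y k * y l), h0, smul_zero, smul_zero, add_zero]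
  · rw [sum_cremmerGervais_smul_of_gt hp (fun k l => y k * y l) hij,
      sum_band_eq_zero (fun k l => y k * y l) j i i fun k l _ _ _ => hanti i k l, smul_zero,
      add_zero]
    have := hanti i i j
    rw [sub_self, mul_zero, zpow_zero, one_smul] at this
    rw [eq_neg_of_add_eq_zero_right this]
    module

/-- Operators on sequences in the exterior algebra of `ℂⁿ` that represent the generators. -/
noncomputable def creation (n : ℕ) (p : ℂ) (i : Fin n) :
    Module.End ℂ (ℤ → ExteriorAlgebra ℂ (Fin n → ℂ)) where
  toFun F m := p ^ (-2 * (i : ℤ) * m) • (ExteriorAlgebra.ι ℂ (Pi.single i 1) * F (m + 1))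
  map_add' F G := by
    ext m
    simp [mul_add]
  map_smul' c F := by
    ext m
    simp [smul_comm c]

theorem creation_apply (i : Fin n) (F : ℤ → ExteriorAlgebra ℂ (Fin n → ℂ)) (m : ℤ) :
    creation n p i F m =
      p ^ (-2 * (i : ℤ) * m) • (ExteriorAlgebra.ι ℂ (Pi.single i 1) * F (m + 1)) := rfl

theorem creation_mul_self (i : Fin n) : creation n p i * creation n p i = 0 := by
  ext F m
  simp [creation_apply, ← mul_assoc]

/-- The shift in `m` makes the scalar depend on the order: `p^{-2jm} p^{-2i(m+1)}` against `p^{-2im}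
p^{-2j(m+1)}`, with ratio `p^{2(j-i)}`. The sign comes from the wedge product. -/
theorem creation_mul (hp : p ≠ 0) (i j : Fin n) :
    creation n p j * creation n p i =
      -(p ^ (2 * ((j : ℤ) - (i : ℤ))) • (creation n p i * creation n p j)) := by
  ext F m
  simp only [Module.End.mul_apply, LinearMap.neg_apply, LinearMap.smul_apply, Pi.neg_apply,
    Pi.smul_apply, creation_apply, mul_smul_comm, smul_smul, ← mul_assoc, ← zpow_add₀ hp]
  rw [eq_neg_of_add_eq_zero_left (ExteriorAlgebra.ι_add_mul_swap (R := ℂ)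
    (Pi.single j (1 : ℂ) : Fin n → ℂ) (Pi.single i 1)), neg_mul (_ * _), smul_neg]
  congr 3
  ring

/-- The representation of `Λ(R)` by `creation` operators. -/
noncomputable def creationHom (hp : p ≠ 0) :
    CGExterior n q p →ₐ[ℂ] Module.End ℂ (ℤ → ExteriorAlgebra ℂ (Fin n → ℂ)) :=
  RingQuot.liftAlgHom ℂ ⟨FreeAlgebra.lift ℂ (creation n p), by
    rintro _ _ ⟨i, j⟩
    simpa [map_sum] using
      rel_of_skewComm hp (creation n p) creation_mul_self (fun i j _ => creation_mul hp i j) i j⟩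

theorem creationHom_x (hp : p ≠ 0) (i : Fin n) :
    creationHom (q := q) hp (x n q p i) = creation n p i := by
  unfold creationHom x mk
  erw [RingQuot.liftAlgHom_mkAlgHom_apply]
  simp

theorem prod_creation_apply (hp : p ≠ 0) (w : List (Fin n)) (m : ℤ) :
    ∃ c : ℂ, c ≠ 0 ∧ (w.map (creation n p)).prod (fun _ => 1) m =
      c • (w.map fun i => ExteriorAlgebra.ι ℂ (Pi.single i (1 : ℂ))).prod := by
  induction w generalizing m with
  | nil => exact ⟨1, one_ne_zero, by simp⟩
  | cons i w ih =>
    obtain ⟨c, hc, h⟩ := ih (m + 1)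
    refine ⟨p ^ (-2 * (i : ℤ) * m) * c, mul_ne_zero (zpow_ne_zero _ hp) hc, ?_⟩
    rw [List.map_cons, List.prod_cons, Module.End.mul_apply, creation_apply, h, List.map_cons,
      List.prod_cons, mul_smul_comm, smul_smul]

/-- The determinant, as a functional on the exterior algebra, takes the value `det 1 = 1` on this
product. -/
theorem prod_ι_single_ne_zero (n : ℕ) :
    (List.ofFn fun i : Fin n => ExteriorAlgebra.ι ℂ (Pi.single i (1 : ℂ) : Fin n → ℂ)).prod ≠ 0 := by
  intro h
  have h1 := ExteriorAlgebra.ιMulti_apply (R := ℂ) (fun i : Fin n => (Pi.single i (1 : ℂ) : Fin n → ℂ))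
  rw [h] at h1
  have h2 := ExteriorAlgebra.liftAlternating_apply_ιMulti
    (Pi.single n (Matrix.detRowAlternating (R := ℂ) (n := Fin n)))
    (fun i : Fin n => (Pi.single i (1 : ℂ) : Fin n → ℂ))
  rw [h1, map_zero, Pi.single_eq_same] at h2
  have h3 : (fun i : Fin n => (Pi.single i (1 : ℂ) : Fin n → ℂ)) = (1 : Matrix (Fin n) (Fin n) ℂ) := by
    ext i j
    simp [Matrix.one_apply, Pi.single_apply, eq_comm]
  rw [h3] at h2
  exact zero_ne_one (h2.trans Matrix.det_one)

theorem top_ne_zero (hp : p ≠ 0) : top n q p ≠ 0 := by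
  intro h
  have h1 := congrArg (creationHom (q := q) hp) h
  rw [top, prodX, map_zero, map_list_prod, List.map_ofFn] at h1
  obtain ⟨c, hc, h2⟩ := prod_creation_apply hp (List.ofFn (id : Fin n → Fin n)) 0
  simp only [List.map_ofFn, Function.comp_def, id, creationHom_x] at h1 h2
  rw [h1] at h2
  exact smul_ne_zero hc (prod_ι_single_ne_zero n) h2.symm

/-- The monomial `x_{i₁} ⋯ x_{iᵣ}`. -/
noncomputable def word (n : ℕ) (q p : ℂ) (w : List (Fin n)) : CGExterior n q p :=
  (w.map (x n q p)).prod

theorem word_cons (i : Fin n) (w : List (Fin n)) :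
    word n q p (i :: w) = x n q p i * word n q p w := by simp [word]

theorem word_append (v w : List (Fin n)) :
    word n q p (v ++ w) = word n q p v * word n q p w := by simp [word]

theorem prodX_eq_word (f : Fin n → Fin n) : prodX n q p f = word n q p (List.ofFn f) := by
  rw [prodX, word, List.map_ofFn]
  rfl

theorem x_mul_x_swap (hq : q ≠ 0) (hp : p ≠ 0) (hq2 : q ^ 2 ≠ -1) (i j : Fin n) :
    ∃ c : ℂ, c ≠ 0 ∧ x n q p i * x n q p j = c • (x n q p j * x n q p i) := by
  rcases lt_trichotomy i j with hij | rfl | hij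
  · refine ⟨-(p ^ (2 * ((j : ℤ) - (i : ℤ))))⁻¹, neg_ne_zero.mpr (inv_ne_zero (zpow_ne_zero _ hp)), ?_⟩
    rw [x_mul_x_of_lt hq hp hq2 hij, smul_neg, neg_smul, neg_neg, smul_smul,
      inv_mul_cancel₀ (zpow_ne_zero _ hp), one_smul]
  · exact ⟨1, one_ne_zero, (one_smul _ _).symm⟩
  · exact ⟨-(p ^ (2 * ((i : ℤ) - (j : ℤ)))), neg_ne_zero.mpr (zpow_ne_zero _ hp), by
      rw [x_mul_x_of_lt hq hp hq2 hij, neg_smul]⟩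

theorem x_mul_word_of_mem (hq : q ≠ 0) (hp : p ≠ 0) (hq2 : q ^ 2 ≠ -1) {i : Fin n}
    {w : List (Fin n)} (h : i ∈ w) : x n q p i * word n q p w = 0 := by
  induction w with
  | nil => simp at h
  | cons j w ih =>
    rw [word_cons, ← mul_assoc]
    rcases List.mem_cons.mp h with rfl | h
    · rw [x_mul_self hq hp hq2, zero_mul]
    · obtain ⟨c, _, hc⟩ := x_mul_x_swap hq hp hq2 i j
      rw [hc, smul_mul_assoc, mul_assoc, ih h, mul_zero, smul_zero]

theorem word_mul_x_of_mem (hq : q ≠ 0) (hp : p ≠ 0) (hq2 : q ^ 2 ≠ -1) {i : Fin n}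
    {w : List (Fin n)} (h : i ∈ w) : word n q p w * x n q p i = 0 := by
  induction w with
  | nil => simp at h
  | cons j w ih =>
    rcases List.mem_cons.mp h with rfl | h
    · by_cases hw : i ∈ w
      · rw [word_cons, mul_assoc, ih hw, mul_zero]
      · have : ∀ v : List (Fin n), x n q p i * (word n q p v * x n q p i) = 0 := by
          intro v
          induction v with
          | nil => simp [word, x_mul_self hq hp hq2]
          | cons l v ihv =>
            obtain ⟨c, _, hc⟩ := x_mul_x_swap hq hp hq2 i l
            rw [word_cons, mul_assoc, ← mul_assoc, hc, smul_mul_assoc, mul_assoc, ihv, mul_zero,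
              smul_zero]
        rw [word_cons, mul_assoc, this]
    · rw [word_cons, mul_assoc, ih h, mul_zero]

theorem word_eq_zero (hq : q ≠ 0) (hp : p ≠ 0) (hq2 : q ^ 2 ≠ -1) {w : List (Fin n)}
    (h : ¬ w.Nodup) : word n q p w = 0 := by
  induction w with
  | nil => simp at h
  | cons i w ih =>
    by_cases hi : i ∈ w
    · rw [word_cons, x_mul_word_of_mem hq hp hq2 hi]
    · rw [word_cons, ih (fun hw => h (List.nodup_cons.mpr ⟨hi, hw⟩)), mul_zero]

theorem word_perm (hq : q ≠ 0) (hp : p ≠ 0) (hq2 : q ^ 2 ≠ -1) {v w : List (Fin n)}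
    (h : v.Perm w) : ∃ c : ℂ, c ≠ 0 ∧ word n q p v = c • word n q p w := by
  induction h with
  | nil => exact ⟨1, one_ne_zero, (one_smul _ _).symm⟩
  | cons i _ ih =>
    obtain ⟨c, hc, h⟩ := ih
    exact ⟨c, hc, by rw [word_cons, word_cons, h, mul_smul_comm]⟩
  | swap i j w =>
    obtain ⟨c, hc, h⟩ := x_mul_x_swap hq hp hq2 j i
    refine ⟨c, hc, ?_⟩
    rw [word_cons, word_cons, word_cons, word_cons, ← mul_assoc, h, smul_mul_assoc, mul_assoc]
  | trans _ _ ih1 ih2 =>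
    obtain ⟨c, hc, h⟩ := ih1
    obtain ⟨d, hd, h'⟩ := ih2
    exact ⟨c * d, mul_ne_zero hc hd, by rw [h, h', smul_smul]⟩

theorem exists_word_eq_smul_top (hq : q ≠ 0) (hp : p ≠ 0) (hq2 : q ^ 2 ≠ -1) {w : List (Fin n)}
    (hw : w.Perm (List.finRange n)) : ∃ c : ℂ, c ≠ 0 ∧ word n q p w = c • top n q p := by
  rw [top, prodX_eq_word, List.ofFn_id]
  exact word_perm hq hp hq2 hw

end CGExterior

/-! ### The quantum determinant -/

theorem tmul_right_cancel {V W : Type*} [AddCommGroup V] [Module ℂ V] [AddCommGroup W] [Module ℂ W]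
    {v v' : V} {w : W} (hw : w ≠ 0) (h : v ⊗ₜ[ℂ] w = v' ⊗ₜ[ℂ] w) : v = v' := by
  obtain ⟨f, hf⟩ : ∃ f : Module.Dual ℂ W, f w ≠ 0 := by
    by_contra! hall
    exact hw ((Module.forall_dual_apply_eq_zero_iff ℂ w).mp hall)
  have := congrArg (TensorProduct.rid ℂ V ∘ f.lTensor V) h
  simp only [Function.comp_apply, LinearMap.lTensor_tmul, TensorProduct.rid_tmul] at this
  exact smul_right_injective V hf this

theorem prod_ofFn_sum {A : Type*} [Ring A] [Algebra ℂ A] {n : ℕ} (f : Fin n → Fin n → A) :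
    (List.ofFn fun i => ∑ j, f i j).prod =
      ∑ g : Fin n → Fin n, (List.ofFn fun i => f i (g i)).prod := by
  have := (MultilinearMap.mkPiAlgebraFin ℂ n A).map_sum f
  simpa only [MultilinearMap.mkPiAlgebraFin_apply] using this

theorem prod_ofFn_tmul {A B : Type*} [Ring A] [Algebra ℂ A] [Ring B] [Algebra ℂ B] {n : ℕ}
    (a : Fin n → A) (b : Fin n → B) :
    (List.ofFn fun i => a i ⊗ₜ[ℂ] b i).prod = (List.ofFn a).prod ⊗ₜ[ℂ] (List.ofFn b).prod := by
  induction n with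
  | zero => simp [Algebra.TensorProduct.one_def]
  | succ n ih =>
    simp only [List.ofFn_succ, List.prod_cons, ih (fun i => a i.succ) (fun i => b i.succ),
      Algebra.TensorProduct.tmul_mul_tmul]

namespace CGExterior

variable {n : ℕ} {q p : ℂ}

theorem hom_ext {B : Type*} [Semiring B] [Algebra ℂ B] {f g : CGExterior n q p →ₐ[ℂ] B}
    (h : ∀ i, f (x n q p i) = g (x n q p i)) : f = g := by
  apply RingQuot.ringQuot_ext'
  apply FreeAlgebra.hom_ext
  funext i
  exact h i

theorem coaction_top :
    coaction n q p (top n q p) = ∑ g : Fin n → Fin n,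
      (List.ofFn fun i => CGAlgebra.T n q p i (g i)).prod ⊗ₜ[ℂ] prodX n q p g := by
  rw [top, prodX, map_list_prod, List.map_ofFn]
  simp only [Function.comp_def, id, coaction_x]
  rw [prod_ofFn_sum]
  exact Finset.sum_congr rfl fun g _ => prod_ofFn_tmul _ _

theorem ofFn_perm_finRange (σ : Equiv.Perm (Fin n)) :
    (List.ofFn σ).Perm (List.finRange n) := by
  rw [← List.ofFn_id]
  exact σ.ofFn_comp_perm id

theorem prodX_perm (hq : q ≠ 0) (hp : p ≠ 0) (hq2 : q ^ 2 ≠ -1) (σ : Equiv.Perm (Fin n)) :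
    ∃ c : ℂ, prodX n q p σ = c • top n q p := by
  obtain ⟨c, -, h⟩ := exists_word_eq_smul_top hq hp hq2 (ofFn_perm_finRange σ)
  exact ⟨c, by rw [prodX_eq_word, h]⟩

theorem coaction_top_eq (hq : q ≠ 0) (hp : p ≠ 0) (hq2 : q ^ 2 ≠ -1)
    {a : Equiv.Perm (Fin n) → ℂ} (ha : ∀ σ : Equiv.Perm (Fin n), prodX n q p σ = a σ • top n q p) :
    coaction n q p (top n q p) = (∑ σ : Equiv.Perm (Fin n),
      a σ • (List.ofFn fun i : Fin n => CGAlgebra.T n q p i (σ i)).prod) ⊗ₜ[ℂ] top n q p := by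
  rw [coaction_top, TensorProduct.sum_tmul]
  symm
  refine Finset.sum_of_injOn (fun σ : Equiv.Perm (Fin n) => (σ : Fin n → Fin n))
    (fun σ _ τ _ h => DFunLike.coe_injective h) (fun _ _ => Finset.mem_coe.mpr (Finset.mem_univ _))
    (fun g _ hg => ?_) (fun σ _ => ?_)
  -- An index map that is not a permutation repeats a letter, so its term vanishes.
  · rw [prodX_eq_word, word_eq_zero hq hp hq2, TensorProduct.tmul_zero]
    rw [List.nodup_ofFn]
    intro hinj
    exact hg ⟨Equiv.ofBijective g (Finite.injective_iff_bijective.mp hinj),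
      Finset.mem_coe.mpr (Finset.mem_univ _), rfl⟩
  · rw [ha, TensorProduct.tmul_smul, TensorProduct.smul_tmul']

theorem existsUnique_quantumDet (hq : q ≠ 0) (hp : p ≠ 0) (hq2 : q ^ 2 ≠ -1) :
    ∃! d : CGAlgebra n q p, IsQuantumDet n q p d := by
  choose a ha using fun σ => prodX_perm (n := n) hq hp hq2 σ
  refine ⟨_, coaction_top_eq hq hp hq2 ha, fun d hd => ?_⟩
  unfold IsQuantumDet at hd
  rw [coaction_top_eq hq hp hq2 ha] at hd
  exact (tmul_right_cancel (top_ne_zero hp) hd).symm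

theorem coaction_coassoc :
    ((Algebra.TensorProduct.assoc ℂ ℂ ℂ (CGAlgebra n q p) (CGAlgebra n q p)
      (CGExterior n q p)).toAlgHom.comp
        (Algebra.TensorProduct.map (Bialgebra.comulAlgHom ℂ (CGAlgebra n q p))
          (AlgHom.id ℂ (CGExterior n q p)))).comp (coaction n q p) =
      (Algebra.TensorProduct.map (AlgHom.id ℂ (CGAlgebra n q p)) (coaction n q p)).comp
        (coaction n q p) := by
  apply hom_ext
  intro i
  simp only [AlgHom.comp_apply, coaction_x, map_sum, Algebra.TensorProduct.map_tmul,
    Bialgebra.comulAlgHom_apply, FRTAlgebra.comul_T, TensorProduct.sum_tmul,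
    TensorProduct.tmul_sum, AlgHom.id_apply]
  rw [Finset.sum_comm]
  rfl

theorem coaction_counit :
    ((Algebra.TensorProduct.lid ℂ (CGExterior n q p)).toAlgHom.comp
        (Algebra.TensorProduct.map (Bialgebra.counitAlgHom ℂ (CGAlgebra n q p))
          (AlgHom.id ℂ (CGExterior n q p)))).comp (coaction n q p) =
      AlgHom.id ℂ (CGExterior n q p) := by
  apply hom_ext
  intro i
  simp [coaction_x, FRTAlgebra.counit_T]

end CGExterior

section Determinant

open CGExterior

variable {n : ℕ} {q p : ℂ} {d : CGAlgebra n q p}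

/-- The top form spans a one-dimensional subcomodule; the comodule axioms, evaluated there, become
the group-like conditions after cancelling the nonzero top form. -/
theorem IsQuantumDet.isGroupLikeElem (hp : p ≠ 0) (hd : IsQuantumDet n q p d) :
    IsGroupLikeElem ℂ d where
  counit_eq_one := by
    have h := DFunLike.congr_fun (coaction_counit (n := n) (q := q) (p := p)) (top n q p)
    rw [AlgHom.comp_apply, hd] at h
    have h' : Coalgebra.counit (R := ℂ) d • top n q p = (1 : ℂ) • top n q p := by
      rw [one_smul]
      exact h
    exact smul_left_injective ℂ (top_ne_zero hp) h'
  comul_eq_tmul_self := by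
    have h := DFunLike.congr_fun (coaction_coassoc (n := n) (q := q) (p := p)) (top n q p)
    rw [AlgHom.comp_apply, AlgHom.comp_apply, hd, Algebra.TensorProduct.map_tmul,
      AlgHom.comp_apply, hd, Algebra.TensorProduct.map_tmul, hd] at h
    refine tmul_right_cancel (top_ne_zero (n := n) (q := q) hp) ?_
    exact (Algebra.TensorProduct.assoc ℂ ℂ ℂ (CGAlgebra n q p) (CGAlgebra n q p)
      (CGExterior n q p)).injective h

theorem IsQuantumDet.coaction_word (hq : q ≠ 0) (hp : p ≠ 0) (hq2 : q ^ 2 ≠ -1)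
    (hd : IsQuantumDet n q p d) {w : List (Fin n)} (hw : w.Perm (List.finRange n)) :
    coaction n q p (word n q p w) = d ⊗ₜ[ℂ] word n q p w := by
  obtain ⟨c, -, h⟩ := exists_word_eq_smul_top hq hp hq2 hw
  rw [h, map_smul, hd, TensorProduct.tmul_smul]

end Determinant

/-! ### Values of the braiding on the determinant, and normality. -/

section Values

open CGExterior Coalgebra

variable {n : ℕ} {q p : ℂ}

/-- Listing the indices by decreasing distance from `s`. -/
theorem exists_list_pairwise_dist (s : Fin n) : ∃ w : List (Fin n), w.Perm (List.finRange n) ∧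
    w.Pairwise (fun a b : Fin n => Nat.dist b s ≤ Nat.dist a s) := by
  classical
  let r : Fin n → Fin n → Prop := fun a b => Nat.dist b s ≤ Nat.dist a s
  have : Std.Total r := ⟨fun a b => le_total _ _⟩
  have : IsTrans (Fin n) r := ⟨fun a b c h1 h2 => h2.trans h1⟩
  exact ⟨(List.finRange n).insertionSort r, List.perm_insertionSort r _,
    List.pairwise_insertionSort r _⟩

theorem dist_lt_of_cremmerGervais_left {s j t k : Fin n} (h : cremmerGervais n q p s j t k ≠ 0)
    (ht : s ≠ t) : Nat.dist k s < Nat.dist j s := by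
  unfold cremmerGervais at h
  simp only [Nat.dist]
  split_ifs at h with h1 h2 h3 h4
  · exact absurd h1.1 ht
  · exact absurd h2.1 ht
  · simp only [Fin.le_def, Fin.lt_def] at h3
    omega
  · simp only [Fin.lt_def] at h4
    omega
  · simp at h

theorem dist_lt_of_cremmerGervais_right {s j t k : Fin n} (h : cremmerGervais n q p j s k t ≠ 0)
    (ht : s ≠ t) : Nat.dist k s < Nat.dist j s := by
  unfold cremmerGervais at h
  simp only [Nat.dist]
  split_ifs at h with h1 h2 h3 h4
  · exact absurd h1.2.1 ht
  · exact absurd h2.2.1 ht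
  · simp only [Fin.le_def, Fin.lt_def, ne_eq, Fin.ext_iff] at h3 ht
    omega
  · simp only [Fin.lt_def] at h4
    omega
  · simp at h

variable (β : CGAlgebra n q p ⊗[ℂ] CGAlgebra n q p →ₗ[ℂ] ℂ)

/-- `a ⊗ y ↦ ⟨a | T_s^t⟩ y`. -/
noncomputable def pairContractRight (s t : Fin n) :
    CGAlgebra n q p ⊗[ℂ] CGExterior n q p →ₗ[ℂ] CGExterior n q p :=
  (TensorProduct.lid ℂ _).toLinearMap ∘ₗ
    (pairingRight β (CGAlgebra.T n q p s t)).ofConv.rTensor _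

/-- `a ⊗ y ↦ ⟨T_s^t | a⟩ y`. -/
noncomputable def pairContractLeft (s t : Fin n) :
    CGAlgebra n q p ⊗[ℂ] CGExterior n q p →ₗ[ℂ] CGExterior n q p :=
  (TensorProduct.lid ℂ _).toLinearMap ∘ₗ
    (pairingLeft β (CGAlgebra.T n q p s t)).ofConv.rTensor _

variable {β}

theorem pairContractRight_tmul (s t : Fin n) (a : CGAlgebra n q p) (y : CGExterior n q p) :
    pairContractRight β s t (a ⊗ₜ y) = β (a ⊗ₜ CGAlgebra.T n q p s t) • y := rfl

theorem pairContractLeft_tmul (s t : Fin n) (a : CGAlgebra n q p) (y : CGExterior n q p) :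
    pairContractLeft β s t (a ⊗ₜ y) = β (CGAlgebra.T n q p s t ⊗ₜ a) • y := rfl

theorem pairContractRight_mul (h : IsMulPairing β) (s t : Fin n)
    (z w : CGAlgebra n q p ⊗[ℂ] CGExterior n q p) :
    pairContractRight β s t (z * w) = ∑ m, pairContractRight β m t z * pairContractRight β s m w := by
  induction z using TensorProduct.induction_on with
  | zero => simp
  | add a b ha hb => simp only [add_mul, map_add, ha, hb, Finset.sum_add_distrib]
  | tmul x y =>
    induction w using TensorProduct.induction_on with
    | zero => simp
    | add a b ha hb => simp only [mul_add, map_add, ha, hb, Finset.sum_add_distrib]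
    | tmul x' y' =>
      rw [Algebra.TensorProduct.tmul_mul_tmul, pairContractRight_tmul,
        h.apply_mul_left (FRTAlgebra.reprT _ s t)]
      simp only [pairContractRight_tmul, smul_mul_smul_comm, Finset.sum_smul, FRTAlgebra.reprT]
      exact Finset.sum_congr rfl fun _ _ => by rw [mul_comm]

theorem pairContractLeft_mul (h : IsMulPairing β) (s t : Fin n)
    (z w : CGAlgebra n q p ⊗[ℂ] CGExterior n q p) :
    pairContractLeft β s t (z * w) = ∑ m, pairContractLeft β s m z * pairContractLeft β m t w := by
  induction z using TensorProduct.induction_on with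
  | zero => simp
  | add a b ha hb => simp only [add_mul, map_add, ha, hb, Finset.sum_add_distrib]
  | tmul x y =>
    induction w using TensorProduct.induction_on with
    | zero => simp
    | add a b ha hb => simp only [mul_add, map_add, ha, hb, Finset.sum_add_distrib]
    | tmul x' y' =>
      rw [Algebra.TensorProduct.tmul_mul_tmul, pairContractLeft_tmul,
        h.apply_mul_right (FRTAlgebra.reprT _ s t)]
      simp only [pairContractLeft_tmul, smul_mul_smul_comm, Finset.sum_smul, FRTAlgebra.reprT]

theorem pairContractRight_coaction_x (h : IsCGBraiding n q p β) (s t j : Fin n) :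
    pairContractRight β s t (coaction n q p (x n q p j)) =
      ∑ k, cremmerGervais n q p s j t k • x n q p k := by
  rw [coaction_x, map_sum]
  simp only [pairContractRight_tmul, h.2]

theorem pairContractLeft_coaction_x (h : IsCGBraiding n q p β) (s t j : Fin n) :
    pairContractLeft β s t (coaction n q p (x n q p j)) =
      ∑ k, cremmerGervais n q p j s k t • x n q p k := by
  rw [coaction_x, map_sum]
  simp only [pairContractLeft_tmul, h.2]

/-- `hclosed` keeps every index closer to `s` than a letter of `w` inside `w`, so the induction can
drop the farthest letter `j`. When `t ≠ s`, contracting `j` yields only letters `x_k` strictly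
closer to `s`; these are repeated in the tail and annihilate it. When `t = s`, the support condition
forces `k = j`. -/
theorem pairContractRight_word (hq : q ≠ 0) (hp : p ≠ 0) (hq2 : q ^ 2 ≠ -1)
    (h : IsCGBraiding n q p β) (s t : Fin n) {w : List (Fin n)}
    (hw : w.Pairwise (fun a b : Fin n => Nat.dist b s ≤ Nat.dist a s))
    (hclosed : ∀ j ∈ w, ∀ k : Fin n, Nat.dist k s < Nat.dist j s → k ∈ w) :
    pairContractRight β s t (coaction n q p (word n q p w)) =
      if s = t then (w.map fun j => cremmerGervais n q p s j s j).prod • word n q p w else 0 := by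
  induction w generalizing t with
  | nil =>
    rw [word, List.map_nil, List.prod_nil, map_one, Algebra.TensorProduct.one_def,
      pairContractRight_tmul, h.1.isMulPairing.apply_one_left, FRTAlgebra.counit_T]
    split_ifs <;> simp
  | cons j v ih =>
    rw [List.pairwise_cons] at hw
    have hmem : ∀ k : Fin n, Nat.dist k s < Nat.dist j s → k ∈ v := fun k hk =>
      (List.mem_cons.mp (hclosed j (List.mem_cons_self ..) k hk)).resolve_left (by
        rintro rfl
        exact lt_irrefl _ hk)
    have ih' := fun t => ih t hw.2 (fun j' hj' k hk => hmem k (hk.trans_le (hw.1 j' hj')))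
    rw [word_cons, map_mul, pairContractRight_mul h.1.isMulPairing]
    -- Only the intermediate index `m = s` survives, so the leading letter is contracted with
    -- `T_s^t` itself.
    simp only [ih', mul_ite, mul_zero, Finset.sum_ite_eq, Finset.mem_univ, if_true]
    rw [pairContractRight_coaction_x h, mul_smul_comm, Finset.sum_mul]
    split_ifs with hst
    · subst hst
      rw [Finset.sum_eq_single j]
      · rw [smul_mul_assoc, smul_smul, List.map_cons, List.prod_cons, mul_comm]
      · intro k _ hk
        have h0 : cremmerGervais n q p s j s k = 0 := by
          by_contra h0
          have := cremmerGervais_support h0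
          exact hk (Fin.ext (by omega))
        rw [h0, zero_smul, zero_mul]
      · simp
    · rw [Finset.sum_eq_zero, smul_zero]
      intro k _
      by_cases h0 : cremmerGervais n q p s j t k = 0
      · rw [h0, zero_smul, zero_mul]
      · rw [smul_mul_assoc, x_mul_word_of_mem hq hp hq2
          (hmem k (dist_lt_of_cremmerGervais_left h0 hst)), smul_zero]

/-- The left pairing is multiplicative rather than antimultiplicative, so the intermediate index
runs the other way. Hence the word is reversed and its last letter is the farthest from `s`. -/
theorem pairContractLeft_word (hq : q ≠ 0) (hp : p ≠ 0) (hq2 : q ^ 2 ≠ -1)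
    (h : IsCGBraiding n q p β) (s t : Fin n) {w : List (Fin n)}
    (hw : w.Pairwise (fun a b : Fin n => Nat.dist b s ≤ Nat.dist a s))
    (hclosed : ∀ j ∈ w, ∀ k : Fin n, Nat.dist k s < Nat.dist j s → k ∈ w) :
    pairContractLeft β s t (coaction n q p (word n q p w.reverse)) =
      if s = t then (w.map fun j => cremmerGervais n q p j s j s).prod • word n q p w.reverse
      else 0 := by
  induction w generalizing t with
  | nil =>
    rw [List.reverse_nil, word, List.map_nil, List.prod_nil, map_one,
      Algebra.TensorProduct.one_def, pairContractLeft_tmul, h.1.isMulPairing.apply_one_right,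
      FRTAlgebra.counit_T]
    split_ifs <;> simp
  | cons j v ih =>
    rw [List.pairwise_cons] at hw
    have hmem : ∀ k : Fin n, Nat.dist k s < Nat.dist j s → k ∈ v := fun k hk =>
      (List.mem_cons.mp (hclosed j (List.mem_cons_self ..) k hk)).resolve_left (by
        rintro rfl
        exact lt_irrefl _ hk)
    have ih' := fun t => ih t hw.2 (fun j' hj' k hk => hmem k (hk.trans_le (hw.1 j' hj')))
    have hj : word n q p [j] = x n q p j := by simp [word]
    rw [List.reverse_cons, word_append, hj, map_mul, pairContractLeft_mul h.1.isMulPairing]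
    simp only [ih', ite_mul, zero_mul, Finset.sum_ite_eq, Finset.mem_univ, if_true]
    rw [pairContractLeft_coaction_x h, smul_mul_assoc, Finset.mul_sum]
    split_ifs with hst
    · subst hst
      rw [Finset.sum_eq_single j]
      · rw [mul_smul_comm, smul_smul, List.map_cons, List.prod_cons, mul_comm]
      · intro k _ hk
        have h0 : cremmerGervais n q p j s k s = 0 := by
          by_contra h0
          have := cremmerGervais_support h0
          exact hk (Fin.ext (by omega))
        rw [h0, zero_smul, mul_zero]
      · simp
    · rw [Finset.sum_eq_zero, smul_zero]
      intro k _
      by_cases h0 : cremmerGervais n q p j s k t = 0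
      · rw [h0, zero_smul, mul_zero]
      · rw [mul_smul_comm, word_mul_x_of_mem hq hp hq2
          (List.mem_reverse.mpr (hmem k (dist_lt_of_cremmerGervais_right h0 hst))), smul_zero]

theorem prod_range_zpow {z : ℂ} (hz : z ≠ 0) (e : ℕ → ℤ) (m : ℕ) :
    ∏ j ∈ Finset.range m, z ^ e j = z ^ ∑ j ∈ Finset.range m, e j := by
  induction m with
  | zero => simp
  | succ m ih => rw [Finset.prod_range_succ, Finset.sum_range_succ, ih, zpow_add₀ hz]

theorem sum_range_two_mul_sub (s m : ℕ) :
    ∑ j ∈ Finset.range m, (-1 + 2 * ((j : ℤ) - s)) = m * (m - 2 * ((s : ℤ) + 1)) := by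
  induction m with
  | zero => simp
  | succ m ih =>
    rw [Finset.sum_range_succ, ih]
    push_cast
    ring

theorem prod_cremmerGervais_diag_left (hq : q ≠ 0) (hp : p ≠ 0) (s : Fin n) :
    ∏ j, cremmerGervais n q p s j s j = (q⁻¹ * p ^ n) ^ ((n : ℤ) - 2 * ((s : ℤ) + 1)) := by
  have hF : ∀ j : Fin n, cremmerGervais n q p s j s j =
      q ^ (if (j : ℕ) ≤ s then 1 else -1 : ℤ) * p ^ (-1 + 2 * ((j : ℤ) - (s : ℤ))) := by
    intro j
    rw [cremmerGervais, zpow_add₀ hp, zpow_neg_one]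
    by_cases hjs : (j : ℕ) ≤ s
    · rw [if_pos ⟨rfl, rfl, hjs⟩, if_pos hjs, zpow_one]
      ring
    · rw [if_neg fun h' => hjs h'.2.2, if_pos ⟨rfl, rfl, not_le.mp hjs⟩, if_neg hjs, zpow_neg_one]
      ring
  -- General `m` serves the induction. At `m = n`, since `s < n`, both branches equal `2(s + 1) -
  -- n`.
  have hsum : ∀ m : ℕ, ∑ j ∈ Finset.range m, (if j ≤ (s : ℕ) then 1 else -1 : ℤ) =
      if m ≤ (s : ℕ) + 1 then (m : ℤ) else 2 * ((s : ℤ) + 1) - m := by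
    intro m
    induction m with
    | zero => simp
    | succ m ih =>
      rw [Finset.sum_range_succ, ih]
      split_ifs <;> push_cast <;> omega
  simp only [hF]
  rw [Fin.prod_univ_eq_prod_range (fun j => q ^ (if j ≤ (s : ℕ) then 1 else -1 : ℤ) *
    p ^ (-1 + 2 * ((j : ℤ) - (s : ℤ)))), Finset.prod_mul_distrib, prod_range_zpow hq,
    prod_range_zpow hp, sum_range_two_mul_sub, hsum, mul_zpow, inv_zpow', ← zpow_natCast p n,
    ← zpow_mul]
  congr 2
  split_ifs <;> omega

theorem prod_cremmerGervais_diag_right (hq : q ≠ 0) (hp : p ≠ 0) (s : Fin n) :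
    ∏ j, cremmerGervais n q p j s j s = (q⁻¹ * p ^ n) ^ (-((n : ℤ) - 2 * ((s : ℤ) + 1) + 2)) := by
  have hF : ∀ j : Fin n, cremmerGervais n q p j s j s =
      q ^ (if (s : ℕ) ≤ j then 1 else -1 : ℤ) * p ^ (-1 + 2 * ((s : ℤ) - (j : ℤ))) := by
    intro j
    rw [cremmerGervais, zpow_add₀ hp, zpow_neg_one]
    by_cases hjs : (s : ℕ) ≤ j
    · rw [if_pos ⟨rfl, rfl, hjs⟩, if_pos hjs, zpow_one]
      ring
    · rw [if_neg fun h' => hjs h'.2.2, if_pos ⟨rfl, rfl, not_le.mp hjs⟩, if_neg hjs, zpow_neg_one]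
      ring
  have hsum : ∀ m : ℕ, ∑ j ∈ Finset.range m, (if (s : ℕ) ≤ j then 1 else -1 : ℤ) =
      if m ≤ (s : ℕ) then -(m : ℤ) else m - 2 * (s : ℤ) := by
    intro m
    induction m with
    | zero => simp
    | succ m ih =>
      rw [Finset.sum_range_succ, ih]
      split_ifs <;> push_cast <;> omega
  have hsum' : ∀ m : ℕ, ∑ j ∈ Finset.range m, (-1 + 2 * ((s : ℤ) - (j : ℤ))) =
      m * (2 * (s : ℤ) - m) := by
    intro m
    induction m with
    | zero => simp
    | succ m ih =>
      rw [Finset.sum_range_succ, ih]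
      push_cast
      ring
  simp only [hF]
  rw [Fin.prod_univ_eq_prod_range (fun j => q ^ (if (s : ℕ) ≤ j then 1 else -1 : ℤ) *
    p ^ (-1 + 2 * ((s : ℤ) - (j : ℤ)))), Finset.prod_mul_distrib, prod_range_zpow hq,
    prod_range_zpow hp, hsum', hsum, mul_zpow, inv_zpow', ← zpow_natCast p n, ← zpow_mul,
    if_neg (by omega)]
  congr 2 <;> ring

variable {d : CGAlgebra n q p}

theorem IsCGBraiding.apply_det_left (hq : q ≠ 0) (hp : p ≠ 0) (hq2 : q ^ 2 ≠ -1)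
    (h : IsCGBraiding n q p β) (hd : IsQuantumDet n q p d) (s t : Fin n) :
    β (d ⊗ₜ CGAlgebra.T n q p s t) =
      if s = t then (q⁻¹ * p ^ n) ^ ((n : ℤ) - 2 * ((s : ℤ) + 1)) else 0 := by
  obtain ⟨w, hw, hpair⟩ := exists_list_pairwise_dist s
  obtain ⟨c, hc, hcw⟩ := exists_word_eq_smul_top hq hp hq2 hw
  have hne : word n q p w ≠ 0 := by
    rw [hcw]
    exact smul_ne_zero hc (top_ne_zero hp)
  -- The word contains all indices, so the closure condition is automatic, and the coaction
  -- multiplies it by `d` whatever the order of its letters.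
  have key := pairContractRight_word hq hp hq2 h s t hpair
    (fun _ _ k _ => hw.mem_iff.mpr (List.mem_finRange k))
  rw [hd.coaction_word hq hp hq2 hw, pairContractRight_tmul, (hw.map _).prod_eq, ← Fin.prod_univ_def,
    prod_cremmerGervais_diag_left hq hp, ← ite_zero_smul] at key
  exact smul_left_injective ℂ hne key

theorem IsCGBraiding.apply_det_right (hq : q ≠ 0) (hp : p ≠ 0) (hq2 : q ^ 2 ≠ -1)
    (h : IsCGBraiding n q p β) (hd : IsQuantumDet n q p d) (s t : Fin n) :
    β (CGAlgebra.T n q p s t ⊗ₜ d) =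
      if s = t then (q⁻¹ * p ^ n) ^ (-((n : ℤ) - 2 * ((s : ℤ) + 1) + 2)) else 0 := by
  obtain ⟨w, hw, hpair⟩ := exists_list_pairwise_dist s
  have hw' := (List.reverse_perm w).trans hw
  obtain ⟨c, hc, hcw⟩ := exists_word_eq_smul_top hq hp hq2 hw'
  have hne : word n q p w.reverse ≠ 0 := by
    rw [hcw]
    exact smul_ne_zero hc (top_ne_zero hp)
  have key := pairContractLeft_word hq hp hq2 h s t hpair
    (fun _ _ k _ => hw.mem_iff.mpr (List.mem_finRange k))
  rw [hd.coaction_word hq hp hq2 hw', pairContractLeft_tmul, (hw.map _).prod_eq, ← Fin.prod_univ_def,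
    prod_cremmerGervais_diag_right hq hp, ← ite_zero_smul] at key
  exact smul_left_injective ℂ hne key

theorem T_mul_det (hq : q ≠ 0) (hp : p ≠ 0) (hq2 : q ^ 2 ≠ -1)
    (h : IsCGBraiding n q p β) (hd : IsQuantumDet n q p d) (i k : Fin n) :
    CGAlgebra.T n q p i k * d =
      (q⁻¹ * p ^ n) ^ (2 * ((i : ℤ) - (k : ℤ))) • (d * CGAlgebra.T n q p i k) := by
  have hQ : q⁻¹ * p ^ n ≠ 0 := mul_ne_zero (inv_ne_zero hq) (pow_ne_zero _ hp)
  -- Because `d` is group-like, its coproduct has one term, and the commutation axiom reads `⟨T_i^i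
  -- | d⟩ d T_i^k = ⟨T_k^k | d⟩ T_i^k d`.
  let r : Coalgebra.Repr ℂ d Unit :=
    { index := Finset.univ
      left := fun _ => d
      right := fun _ => d
      eq := by simp [(hd.isGroupLikeElem hp).comul_eq_tmul_self] }
  have hc := h.1.comm _ _ (FRTAlgebra.reprT (cremmerGervais n q p) i k) r
  simp only [FRTAlgebra.reprT, r, Finset.univ_unique, Finset.sum_singleton] at hc
  have e1 := h.apply_det_right hq hp hq2 hd
  simp only [CGAlgebra.T] at e1 ⊢
  simp only [e1, ite_smul, zero_smul, Finset.sum_ite_eq, Finset.sum_ite_eq', Finset.mem_univ,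
    if_true] at hc
  rw [show 2 * ((i : ℤ) - k) = ((n : ℤ) - 2 * ((k : ℤ) + 1) + 2) +
    -((n : ℤ) - 2 * ((i : ℤ) + 1) + 2) by ring, zpow_add₀ hQ, mul_smul, hc, smul_smul,
    ← zpow_add₀ hQ, add_neg_cancel, zpow_zero, one_smul]

theorem isNormalElem_of_T_mul {c : Fin n → Fin n → ℂ} (hc : ∀ i k, c i k ≠ 0)
    (h : ∀ i k, CGAlgebra.T n q p i k * d = c i k • (d * CGAlgebra.T n q p i k)) :
    IsNormalElem d := by
  -- Elements that can be moved past `d` in both directions form a subalgebra; it contains the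
  -- generators because the scalars `c i k` are invertible.
  have key : ∀ a : CGAlgebra n q p, (∃ b, b * d = d * a) ∧ ∃ b, d * b = a * d := by
    intro a
    induction a using FRTAlgebra.induction with
    | halg z => exact ⟨⟨_, Algebra.commutes z d⟩, ⟨_, (Algebra.commutes z d).symm⟩⟩
    | hT i k =>
      refine ⟨⟨(c i k)⁻¹ • CGAlgebra.T n q p i k, ?_⟩, ⟨c i k • CGAlgebra.T n q p i k, ?_⟩⟩
      · rw [smul_mul_assoc, h, smul_smul, inv_mul_cancel₀ (hc i k), one_smul]
      · rw [mul_smul_comm, ← h]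
    | hadd x y hx hy =>
      obtain ⟨⟨b, hb⟩, ⟨b', hb'⟩⟩ := hx
      obtain ⟨⟨e, he⟩, ⟨e', he'⟩⟩ := hy
      exact ⟨⟨b + e, by rw [add_mul, mul_add, hb, he]⟩, ⟨b' + e', by rw [mul_add, add_mul, hb', he']⟩⟩
    | hmul x y hx hy =>
      obtain ⟨⟨b, hb⟩, ⟨b', hb'⟩⟩ := hx
      obtain ⟨⟨e, he⟩, ⟨e', he'⟩⟩ := hy
      exact ⟨⟨b * e, by rw [mul_assoc, he, ← mul_assoc, hb, mul_assoc]⟩,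
        ⟨b' * e', by rw [← mul_assoc, hb', mul_assoc, he', mul_assoc]⟩⟩
  ext z
  constructor
  · rintro ⟨a, rfl⟩
    exact (key a).1
  · rintro ⟨a, rfl⟩
    exact (key a).2

end Values

theorem mainTheorem10 (n : ℕ) (q p : ℂ) (hq : q ≠ 0) (hp : p ≠ 0) (hq2 : q ^ 2 ≠ -1) :
    (∃! β : TensorProduct ℂ (CGAlgebra n q p) (CGAlgebra n q p) →ₗ[ℂ] ℂ,
      IsCGBraiding n q p β) ∧
    (∃! d : CGAlgebra n q p, IsQuantumDet n q p d) ∧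
    ∀ (β : TensorProduct ℂ (CGAlgebra n q p) (CGAlgebra n q p) →ₗ[ℂ] ℂ)
      (d : CGAlgebra n q p), IsCGBraiding n q p β → IsQuantumDet n q p d →
      IsGroupLikeElem ℂ d ∧
      (∃ a : Equiv.Perm (Fin n) → ℂ,
        (∀ (σ : Equiv.Perm (Fin n)) (c : ℂ),
          CGExterior.prodX n q p σ = c • CGExterior.top n q p ↔ c = a σ) ∧
        d = ∑ σ : Equiv.Perm (Fin n),
          a σ • (List.ofFn fun i : Fin n => CGAlgebra.T n q p i (σ i)).prod) ∧
      (∀ i k : Fin n,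
        β (d ⊗ₜ[ℂ] CGAlgebra.T n q p i k) =
          if i = k then (q⁻¹ * p ^ n) ^ ((n : ℤ) - 2 * ((i : ℤ) + 1)) else 0) ∧
      (∀ i k : Fin n,
        β (CGAlgebra.T n q p i k ⊗ₜ[ℂ] d) =
          if i = k then (q⁻¹ * p ^ n) ^ (-((n : ℤ) - 2 * ((i : ℤ) + 1) + 2)) else 0) ∧
      (∀ i k : Fin n,
        CGAlgebra.T n q p i k * d =
          (q⁻¹ * p ^ n) ^ (2 * ((i : ℤ) - (k : ℤ))) • (d * CGAlgebra.T n q p i k)) ∧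
      IsNormalElem d := by
  refine ⟨existsUnique_cgBraiding hq hp, CGExterior.existsUnique_quantumDet hq hp hq2,
    fun β d hβ hd => ⟨hd.isGroupLikeElem hp, ?_, hβ.apply_det_left hq hp hq2 hd,
      hβ.apply_det_right hq hp hq2 hd, T_mul_det hq hp hq2 hβ hd, ?_⟩⟩
  · choose a ha using fun σ : Equiv.Perm (Fin n) => CGExterior.prodX_perm hq hp hq2 σ
    refine ⟨a, fun σ c => ⟨fun h => ?_, fun h => h ▸ ha σ⟩, ?_⟩
    · rw [ha] at h
      exact (smul_left_injective ℂ (CGExterior.top_ne_zero hp) h).symm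
    · unfold IsQuantumDet at hd
      rw [CGExterior.coaction_top_eq hq hp hq2 ha] at hd
      exact (tmul_right_cancel (CGExterior.top_ne_zero hp) hd).symm
  · exact isNormalElem_of_T_mul
      (fun _ _ => zpow_ne_zero _ (mul_ne_zero (inv_ne_zero hq) (pow_ne_zero _ hp)))
      (T_mul_det hq hp hq2 hβ hd)
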